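/- Let $(M,g)$ be a smooth $(n+m)$-dimensional Riemannian manifold (Hausdorff, second countable, without boundary), $\langle\cdot,\cdot\rangle=g$, equipped with a foliation with $m$-dimensional leaves; let $\mathcal V\subset TM$ be the bundle of vectors tangent to the leaves (a smooth involutive subbundle of rank $m$) and $\mathcal H=\mathcal V^\perp$. Write $u=u_{\mathcal H}+u_{\mathcal V}$ for the orthogonal decomposition, $\mathfrak X(\mathcal W)$ for the smooth sections of a bundle $\mathcal W$, and $\langle X,Y\rangle_{\mathcal H}=\langle X_{\mathcal H},Y_{\mathcal H}\rangle$. Assume that $g$ is bundle-like: $(\mathcal L_Ug)(X,X)=0$ for all (local) smooth sections $U$ of $\mathcal V$ and $X$ of $\mathcal H$. Let $D$ be the Levi-Civita connection of $g$, let $C$ be the tensor $\langle C_XY,Z\rangle=\frac12(\mathcal L_{X_{\mathcal H}}g)(Y_{\mathcal V},Z_{\mathcal V})$, and let $\nabla$ be the connection on $TM$ with $$\nabla_XY=\begin{cases}(D_XY)_{\mathcal H}, & X,Y\in\mathfrak X(\mathcal H),\\ [X,Y]_{\mathcal H}, & X\in\mathfrak X(\mathcal V),\ Y\in\mathfrak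 X(\mathcal H),\\ [X,Y]_{\mathcal V}+C_XY, & X\in\mathfrak X(\mathcal H),\ Y\in\mathfrak X(\mathcal V),\\ (D_XY)_{\mathcal V}, & X,Y\in\mathfrak X(\mathcal V).\end{cases}$$ Let $\mathrm{Tor}(X,Y)=\nabla_XY-\nabla_YX-[X,Y]$ and $\mathrm{Riem}(X,Y)Z=\nabla_X\nabla_YZ-\nabla_Y\nabla_XZ-\nabla_{[X,Y]}Z$ be its torsion and curvature, and let $J_Z$ be the endomorphism with $\langle J_ZX,Y\rangle=\langle Z,\mathrm{Tor}(X,Y)\rangle$. With $(X_i)_{1\le i\le n}$ a local orthonormal frame of $\mathcal H$, put $$\mathfrak R(U,V)=\sum_{i=1}^n\Big(\langle\mathrm{Riem}(U,X_i)X_i,V\rangle-\langle(\nabla_{X_i}\mathrm{Tor})(X_i,U),V\rangle-\langle\mathrm{Tor}(\mathrm{Tor}(U,X_i),X_i),V\rangle+\tfrac14\langle J_UX_i,J_VX_i\rangle_{\mathcal H}-\langle\mathrm{Tor}(X_i,U),\mathrm{Tor}(X_i,V)\rangle\Big),$$ $$\mathrm{Ric}_{\mathcal H}(U,V)=\sum_{i=1}^n\langle\mathrm{Riem}(U,X_i)X_i,V\rangle,\qquad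 \delta_{\mathcal H}\mathrm{Tor}(U)=\sum_{i=1}^n(\nabla_{X_i}\mathrm{Tor})(X_i,U),$$ $$(\mathrm{Tor}_U,\mathrm{Tor}_V)_{\mathcal H}=\sum_{i=1}^n\langle\mathrm{Tor}(U,X_i),\mathrm{Tor}(V,X_i)\rangle,\qquad (J_U,J_V)_{\mathcal H}=\sum_{i=1}^n\langle J_UX_i,J_VX_i\rangle_{\mathcal H}.$$ These five expressions do not depend on the choice of the frame, and: 1. For $X,Y\in\mathfrak X(\mathcal H)$: $\ \mathfrak R(X,Y)=\mathfrak R(Y,X)=\mathrm{Ric}_{\mathcal H}(X,Y)-(\mathrm{Tor}_X,\mathrm{Tor}_Y)_{\mathcal H}$. 2. For $U\in\mathfrak X(\mathcal V)$, $X\in\mathfrak X(\mathcal H)$: $\ \mathfrak R(U,X)=-(\mathrm{Tor}_U,\mathrm{Tor}_X)_{\mathcal H}$. 3. For $U\in\mathfrak X(\mathcal V)$, $X\in\mathfrak X(\mathcal H)$: $\ \mathfrak R(X,U)=-\langle\delta_{\mathcal H}\mathrm{Tor}(X),U\rangle-2(\mathrm{Tor}_U,\mathrm{Tor}_X)_{\mathcal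 H}$. 4. For $U,V\in\mathfrak X(\mathcal V)$: $\ \mathfrak R(U,V)=\mathfrak R(V,U)=-\langle\delta_{\mathcal H}\mathrm{Tor}(U),V\rangle+\frac14(J_U,J_V)_{\mathcal H}-2(\mathrm{Tor}_U,\mathrm{Tor}_V)_{\mathcal H}$. 5. $\mathfrak R$ is symmetric, i.e. $\mathfrak R(U,V)=\mathfrak R(V,U)$ for all $U,V\in\mathfrak X(TM)$, if and only if the horizontal distribution is Yang–Mills, i.e. $$\langle\delta_{\mathcal H}\mathrm{Tor}(X),U\rangle+(\mathrm{Tor}_U,\mathrm{Tor}_X)_{\mathcal H}=0\qquad\text{for all }U\in\mathfrak X(\mathcal V),\ X\in\mathfrak X(\mathcal H).$$ -/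

import Mathlib

open Set Bundle
open scoped Manifold ContDiff

noncomputable section

/-! ## Vector fields and metric data on a Riemannian manifold

`M` is a smooth manifold (without boundary) modelled on the finite dimensional space `E`; the
Riemannian metric is the smooth inner product on the tangent spaces `T_x M`. All operations below
act on vector fields and depend at `x` only on the germs of the fields at `x`; they are meant for
fields which are smooth near `x`. -/

section VectorFields

variable (E : Type*) [NormedAddCommGroup E] [NormedSpace ℝ E]
  (M : Type*) [TopologicalSpace M] [ChartedSpace E M]

/-- Vector fields on `M` (no regularity imposed). -/
abbrev VField : Type _ := Π x : M, TangentSpace 𝓘(ℝ, E) x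

variable {E M}
variable [IsManifold 𝓘(ℝ, E) ∞ M]

/-- `X` is a smooth vector field on the set `s` (used for open sets `s`). -/
def SmoothFieldOn (s : Set M) (X : VField E M) : Prop :=
  ContMDiffOn 𝓘(ℝ, E) (𝓘(ℝ, E).prod 𝓘(ℝ, E)) ∞
    (fun x ↦ (⟨x, X x⟩ : TangentBundle 𝓘(ℝ, E) M)) s

/-- `X ∈ 𝔛(TM)`: a smooth vector field on all of `M`. -/
def SmoothField (X : VField E M) : Prop :=
  ContMDiff 𝓘(ℝ, E) (𝓘(ℝ, E).prod 𝓘(ℝ, E)) ∞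
    (fun x ↦ (⟨x, X x⟩ : TangentBundle 𝓘(ℝ, E) M))

/-- The Lie bracket `[X, Y]` of vector fields. -/
abbrev bracket (X Y : VField E M) : VField E M := VectorField.mlieBracket 𝓘(ℝ, E) X Y

/-- The derivative `X f` of the function `f` in the direction of the vector field `X`. -/
def dirDeriv (X : VField E M) (f : M → ℝ) (x : M) : ℝ := mvfderiv 𝓘(ℝ, E) f x (X x)

/-- A smooth (near `x`) vector field whose value at `x` is the vector `v`. -/
abbrev extendVec {x : M} (v : TangentSpace 𝓘(ℝ, E) x) : VField E M := FiberBundle.extend E v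

instance tangentSpace_finiteDimensional [h : FiniteDimensional ℝ E] (x : M) :
    FiniteDimensional ℝ (TangentSpace 𝓘(ℝ, E) x) := h

variable [RiemannianBundle (fun x : M ↦ TangentSpace 𝓘(ℝ, E) x)]

/-- The function `⟨X, Y⟩ = g(X, Y)`. -/
def metric (X Y : VField E M) (x : M) : ℝ := inner ℝ (X x) (Y x)

/-- The Lie derivative of the metric,
`(𝓛_W g)(X, Y) = W ⟨X, Y⟩ - ⟨[W, X], Y⟩ - ⟨X, [W, Y]⟩`. -/
def lieMetric (W X Y : VField E M) (x : M) : ℝ :=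
  dirDeriv W (metric X Y) x - metric (bracket W X) Y x - metric X (bracket W Y) x

variable [FiniteDimensional ℝ E]

/-- The vector field `W` determined by `⟨W, Z⟩ = φ Z` for all smooth vector fields `Z`, for a
`φ` which is tensorial (function-linear) in `Z`: the value at `x` is
`∑ₖ φ(eₖ)(x) eₖ` for an orthonormal basis `(eₖ)` of `T_x M`, extended to vector fields. -/
def raise (φ : VField E M → M → ℝ) : VField E M := fun x ↦
  ∑ k, φ (extendVec (stdOrthonormalBasis ℝ (TangentSpace 𝓘(ℝ, E) x) k)) x •
    stdOrthonormalBasis ℝ (TangentSpace 𝓘(ℝ, E) x) k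

/-- The Levi-Civita connection `D_X Y`, through Koszul's formula
`2⟨D_X Y, Z⟩ = X⟨Y, Z⟩ + Y⟨Z, X⟩ - Z⟨X, Y⟩ + ⟨[X, Y], Z⟩ - ⟨[Y, Z], X⟩ + ⟨[Z, X], Y⟩`. -/
def leviCivita (X Y : VField E M) : VField E M :=
  raise fun Z x ↦ (1 / 2 : ℝ) *
    (dirDeriv X (metric Y Z) x + dirDeriv Y (metric Z X) x - dirDeriv Z (metric X Y) x
      + metric (bracket X Y) Z x - metric (bracket Y Z) X x + metric (bracket Z X) Y x)

end VectorFields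

/-! ## Foliations -/

/-- A foliation of `M` with `m`-dimensional leaves, given by its vertical bundle (the vectors
tangent to the leaves): a smooth rank `m` subbundle `V` of `TM` which is involutive. -/
structure Foliation (E : Type*) [NormedAddCommGroup E] [NormedSpace ℝ E]
    (M : Type*) [TopologicalSpace M] [ChartedSpace E M] [IsManifold 𝓘(ℝ, E) ∞ M] (m : ℕ) where
  /-- The space `V_x` of vertical vectors at `x`. -/
  V : Π x : M, Submodule ℝ (TangentSpace 𝓘(ℝ, E) x)
  exists_local_frame : ∀ x : M, ∃ s : Set M, IsOpen s ∧ x ∈ s ∧ ∃ Z : Fin m → VField E M,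
    (∀ i, SmoothFieldOn s (Z i)) ∧
    ∀ y ∈ s, LinearIndependent ℝ (fun i ↦ Z i y) ∧ Submodule.span ℝ (range fun i ↦ Z i y) = V y
  involutive : ∀ (s : Set M) (X Y : VField E M), IsOpen s → SmoothFieldOn s X →
    SmoothFieldOn s Y → (∀ x ∈ s, X x ∈ V x) → (∀ x ∈ s, Y x ∈ V x) →
    ∀ x ∈ s, bracket X Y x ∈ V x

namespace Foliation

variable {E : Type*} [NormedAddCommGroup E] [NormedSpace ℝ E]
  {M : Type*} [TopologicalSpace M] [ChartedSpace E M] [IsManifold 𝓘(ℝ, E) ∞ M]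
  [RiemannianBundle (fun x : M ↦ TangentSpace 𝓘(ℝ, E) x)]
  {m : ℕ} (F : Foliation E M m)

/-- The space `H_x` of horizontal vectors at `x`: the orthogonal complement of `V_x`. -/
def H (x : M) : Submodule ℝ (TangentSpace 𝓘(ℝ, E) x) := (F.V x)ᗮ

/-- `U ∈ 𝔛(V)`: a smooth vertical vector field. -/
def VerticalField (U : VField E M) : Prop := SmoothField U ∧ ∀ x, U x ∈ F.V x

/-- `X ∈ 𝔛(H)`: a smooth horizontal vector field. -/
def HorizontalField (X : VField E M) : Prop := SmoothField X ∧ ∀ x, X x ∈ F.H x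

/-- The metric is bundle-like: `(𝓛_U g)(X, X) = 0` for all (local) smooth vertical `U` and
horizontal `X`. -/
def IsBundleLike : Prop :=
  ∀ (s : Set M) (U X : VField E M), IsOpen s → SmoothFieldOn s U → SmoothFieldOn s X →
    (∀ x ∈ s, U x ∈ F.V x) → (∀ x ∈ s, X x ∈ F.H x) → ∀ x ∈ s, lieMetric U X X x = 0

/-- `X₁, …, Xₙ` is a smooth local orthonormal frame of the horizontal bundle over the open
set `s`. -/
structure IsHorizontalFrame {n : ℕ} (s : Set M) (X : Fin n → VField E M) : Prop where
  isOpen : IsOpen s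
  smooth : ∀ i, SmoothFieldOn s (X i)
  orthonormal : ∀ x ∈ s, Orthonormal ℝ (fun i ↦ X i x)
  span_eq : ∀ x ∈ s, Submodule.span ℝ (range fun i ↦ X i x) = F.H x

variable [FiniteDimensional ℝ E]

/-- The horizontal part `X_H` of a vector field. -/
def hor (X : VField E M) : VField E M := fun x ↦ (F.H x).starProjection (X x)

/-- The vertical part `X_V` of a vector field. -/
def ver (X : VField E M) : VField E M := fun x ↦ (F.V x).starProjection (X x)

/-- The tensor `C`: `⟨C_X Y, Z⟩ = ½ (𝓛_{X_H} g)(Y_V, Z_V)`. -/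
def C (X Y : VField E M) : VField E M :=
  raise fun Z x ↦ (1 / 2 : ℝ) * lieMetric (F.hor X) (F.ver Y) (F.ver Z) x

/-- The fundamental connection `∇_X Y` of the foliation: additive in `X` and `Y`, with
`∇_X Y = (D_X Y)_H` for `X, Y` horizontal, `[X, Y]_H` for `X` vertical and `Y` horizontal,
`[X, Y]_V + C_X Y` for `X` horizontal and `Y` vertical, `(D_X Y)_V` for `X, Y` vertical. -/
def nabla (X Y : VField E M) : VField E M :=
  F.hor (leviCivita (F.hor X) (F.hor Y)) + F.hor (bracket (F.ver X) (F.hor Y))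
    + (F.ver (bracket (F.hor X) (F.ver Y)) + F.C (F.hor X) (F.ver Y))
    + F.ver (leviCivita (F.ver X) (F.ver Y))

/-- The torsion `Tor(X, Y) = ∇_X Y - ∇_Y X - [X, Y]`. -/
def Tor (X Y : VField E M) : VField E M := F.nabla X Y - F.nabla Y X - bracket X Y

/-- The curvature `Riem(X, Y) Z = ∇_X ∇_Y Z - ∇_Y ∇_X Z - ∇_{[X, Y]} Z`. -/
def Riem (X Y Z : VField E M) : VField E M :=
  F.nabla X (F.nabla Y Z) - F.nabla Y (F.nabla X Z) - F.nabla (bracket X Y) Z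

/-- The covariant derivative of the torsion,
`(∇_X Tor)(Y, Z) = ∇_X (Tor(Y, Z)) - Tor(∇_X Y, Z) - Tor(Y, ∇_X Z)`. -/
def nablaTor (X Y Z : VField E M) : VField E M :=
  F.nabla X (F.Tor Y Z) - F.Tor (F.nabla X Y) Z - F.Tor Y (F.nabla X Z)

/-- The endomorphism `J_Z`: `⟨J_Z X, Y⟩ = ⟨Z, Tor(X, Y)⟩`. -/
def J (Z X : VField E M) : VField E M := raise fun Y ↦ metric Z (F.Tor X Y)

/-- The inner product of horizontal parts, `⟨X, Y⟩_H = ⟨X_H, Y_H⟩`. -/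
def metricH (X Y : VField E M) : M → ℝ := metric (F.hor X) (F.hor Y)

/-- A horizontal vector field (smooth near `x`), equal at `x` to the `i`-th vector of an
orthonormal basis of `H_x`. -/
def horBasisField (x : M) (i : Fin (Module.finrank ℝ (F.H x))) : VField E M :=
  F.hor (extendVec (stdOrthonormalBasis ℝ (F.H x) i : TangentSpace 𝓘(ℝ, E) x))

/-- The trace over `H_x` of an expression `X ↦ Q X` which is a tensorial quadratic expression
in the horizontal vector field `X`. -/
def trH {A : M → Type*} [∀ x, AddCommMonoid (A x)] (Q : VField E M → Π x, A x) (x : M) : A x :=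
  ∑ i, Q (F.horBasisField x i) x

/-- The summand of the tensor `𝔯(U, V)` belonging to the horizontal vector field `X`. -/
def frakRTerm (U V X : VField E M) (x : M) : ℝ :=
  metric (F.Riem U X X) V x - metric (F.nablaTor X X U) V x
    - metric (F.Tor (F.Tor U X) X) V x + (1 / 4 : ℝ) * F.metricH (F.J U X) (F.J V X) x
    - metric (F.Tor X U) (F.Tor X V) x

/-- The tensor `𝔯`. -/
def frakR (U V : VField E M) : M → ℝ := F.trH (A := fun _ ↦ ℝ) (F.frakRTerm U V)

/-- The horizontal Ricci curvature of `∇`, `∑ᵢ ⟨Riem(U, Xᵢ) Xᵢ, V⟩`. -/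
def ricH (U V : VField E M) : M → ℝ :=
  F.trH (A := fun _ ↦ ℝ) fun X ↦ metric (F.Riem U X X) V

/-- The horizontal divergence of the torsion, `∑ᵢ (∇_{Xᵢ} Tor)(Xᵢ, U)`. -/
def divTor (U : VField E M) : VField E M := F.trH fun X ↦ F.nablaTor X X U

/-- `(Tor_U, Tor_V)_H = ∑ᵢ ⟨Tor(U, Xᵢ), Tor(V, Xᵢ)⟩`. -/
def torTor (U V : VField E M) : M → ℝ :=
  F.trH (A := fun _ ↦ ℝ) fun X ↦ metric (F.Tor U X) (F.Tor V X)

/-- `(J_U, J_V)_H = ∑ᵢ ⟨J_U Xᵢ, J_V Xᵢ⟩_H`. -/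
def JJ (U V : VField E M) : M → ℝ :=
  F.trH (A := fun _ ↦ ℝ) fun X ↦ F.metricH (F.J U X) (F.J V X)

/-- The horizontal distribution is Yang-Mills: `⟨δ_H Tor (X), U⟩ + (Tor_U, Tor_X)_H = 0` for all
smooth vertical `U` and horizontal `X`. -/
def IsYangMills : Prop :=
  ∀ U X : VField E M, F.VerticalField U → F.HorizontalField X →
    ∀ x, metric (F.divTor X) U x + F.torTor U X x = 0

end Foliation

end

/-! The block formulas hold summand by summand, before the trace is taken. They rest on four
properties of `∇`: it is metric (`nab_metric`), it preserves the splitting of `TM` into `H` and `V`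
(`h_nab`), its torsion is vertical (`h_torOf`), and `Tor(·, Y)` is symmetric on `V` (`torOf_symm`).

Since the torsion is vertical, its terms disappear from the horizontal part of the first Bianchi
identity (`h_bianchi`). With the skew-symmetries of the curvature this gives pair symmetry on `H`
(`riemOf_pair_symm`) and the vanishing of `⟨Riem(U, X)Y, Z⟩` for `U` vertical and `X, Y, Z`
horizontal (`g_riemOf_v_h_h`). In each block of `𝔯` most terms then vanish because they pair a
vertical vector with a horizontal one, and symmetry of `Tor(·, e)` turns `⟨Tor(Tor(U, e), e), V⟩`
into `⟨Tor(U, e), Tor(V, e)⟩` for vertical `V`. The two diagonal blocks come out symmetric, and the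
two mixed ones differ by exactly the Yang–Mills expression.

This computation is done in a `FoliatedAlgebroid`, a Lie–Rinehart algebra with a metric and a
projection, where smoothness never appears. `Foliation.algebroid` realises it by the fields smooth
on an open set. On the manifold, `D`, `C` and `J` are defined pointwise from chosen extensions of
vectors; `raise_spec` shows that they are smooth with the expected inner products, and the lemmas on
`Rep` carry identities across. Independence of the frame is `sum_horBasisField_eq`. -/

open TopologicalSpace (Opens)

/-! ### Algebra of the fundamental connection -/

/-- The algebra of vector fields on a foliated Riemannian manifold with bundle-like metric: a Lie
algebra `L` of fields acting by `dd` on a ring `A` of functions, with a metric `g` and the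
projection `h` onto the horizontal fields. -/
structure FoliatedAlgebroid (A L : Type*) [CommRing A] [AddCommGroup L] [Module A L] where
  br : L →+ L →+ L
  dd : L →+ A →+ A
  g : L →ₗ[A] L →ₗ[A] A
  h : L →ₗ[A] L
  two_cancel : ∀ a : A, 2 * a = 0 → a = 0
  br_swap : ∀ X Y, br X Y = -br Y X
  br_smul : ∀ X f Y, br X (f • Y) = dd X f • Y + f • br X Y
  jacobi : ∀ X Y Z, br X (br Y Z) = br (br X Y) Z + br Y (br X Z)
  dd_smul : ∀ f X a, dd (f • X) a = f * dd X a
  dd_mul : ∀ X a b, dd X (a * b) = a * dd X b + dd X a * b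
  dd_br : ∀ X Y a, dd (br X Y) a = dd X (dd Y a) - dd Y (dd X a)
  g_symm : ∀ X Y, g X Y = g Y X
  g_nondeg : ∀ X, g X X = 0 → X = 0
  h_h : ∀ X, h (h X) = h X
  g_h : ∀ X Y, g (h X) Y = g X (h Y)
  involutive : ∀ X Y, h (br (X - h X) (Y - h Y)) = 0
  bundleLike : ∀ U X, dd (U - h U) (g (h X) (h X)) = 2 * g (br (U - h U) (h X)) (h X)

namespace FoliatedAlgebroid

variable {A L : Type*} [CommRing A] [AddCommGroup L] [Module A L] (S : FoliatedAlgebroid A L)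

/-- The vertical projection. -/
def v : L →ₗ[A] L := LinearMap.id - S.h

theorem v_apply (X : L) : S.v X = X - S.h X := rfl

theorem h_add_v (X : L) : S.h X + S.v X = X := by simp [v_apply]

@[simp] theorem h_v (X : L) : S.h (S.v X) = 0 := by simp [v_apply, S.h_h]

@[simp] theorem v_h (X : L) : S.v (S.h X) = 0 := by simp [v_apply, S.h_h]

@[simp] theorem hh_apply (X : L) : S.h (S.h X) = S.h X := S.h_h X

@[simp] theorem v_v (X : L) : S.v (S.v X) = S.v X := by simp [v_apply, S.h_h]

theorem g_v (X Y : L) : S.g (S.v X) Y = S.g X (S.v Y) := by simp [v_apply, S.g_h]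

@[simp] theorem g_h_v (X Y : L) : S.g (S.h X) (S.v Y) = 0 := by simp [S.g_h]

@[simp] theorem g_v_h (X Y : L) : S.g (S.v X) (S.h Y) = 0 := by simp [S.g_v]

theorem br_smul_left (f : A) (X Y : L) : S.br (f • X) Y = f • S.br X Y - S.dd Y f • X := by
  rw [S.br_swap, S.br_smul, S.br_swap Y X]; simp; abel

theorem h_br_v_v (X Y : L) : S.h (S.br (S.v X) (S.v Y)) = 0 := S.involutive X Y

/-- Expand `g (X - Y) (X - Y)` and use that `g` is anisotropic. The factor 2 is kept because `A`
need not contain `1 / 2`, so `D` and `C` are characterised only by their doubled inner products. -/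
theorem ext_g {X Y : L} (H : ∀ Z, 2 * S.g X Z = 2 * S.g Y Z) : X = Y := by
  refine sub_eq_zero.1 (S.g_nondeg _ (S.two_cancel _ ?_))
  rw [map_sub, mul_sub, S.g_symm, S.g_symm _ Y, map_sub, map_sub, S.g_symm X Y, S.g_symm X X,
    S.g_symm Y Y]
  linear_combination H X - H Y + 2 * S.g_symm X Y

include S in
theorem two_cancel' {a b : A} (H : 2 * a = 2 * b) : a = b :=
  sub_eq_zero.1 (S.two_cancel _ (by rw [mul_sub, H, sub_self]))

/-- The right hand side of Koszul's formula, as a linear form in the last field. -/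
def koszul (X Y : L) : L →ₗ[A] A where
  toFun Z := S.dd X (S.g Y Z) + S.dd Y (S.g Z X) - S.dd Z (S.g X Y) + S.g (S.br X Y) Z
    - S.g (S.br Y Z) X + S.g (S.br Z X) Y
  map_add' Z W := by simp only [map_add, LinearMap.add_apply, AddMonoidHom.add_apply]; ring
  -- The derivatives of `f` cancel in pairs: `X f` between the first and last terms, `Y f` between
  -- the second and fifth.
  map_smul' f Z := by
    simp only [map_smul, LinearMap.smul_apply, smul_eq_mul, S.dd_mul, S.dd_smul, S.br_smul,
      S.br_smul_left, map_add, map_sub, LinearMap.add_apply, LinearMap.sub_apply, RingHom.id_apply]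
    rw [S.g_symm Y Z]
    ring

theorem koszul_apply (X Y Z : L) : S.koszul X Y Z =
    S.dd X (S.g Y Z) + S.dd Y (S.g Z X) - S.dd Z (S.g X Y) + S.g (S.br X Y) Z
    - S.g (S.br Y Z) X + S.g (S.br Z X) Y := rfl

/-- The Lie derivative of the metric, as a linear form in the last field. -/
def lie (W X : L) : L →ₗ[A] A where
  toFun Y := S.dd W (S.g X Y) - S.g (S.br W X) Y - S.g X (S.br W Y)
  map_add' Z W := by simp only [map_add]; ring
  map_smul' f Z := by
    simp only [map_smul, smul_eq_mul, S.dd_mul, S.br_smul, map_add, RingHom.id_apply]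
    ring

theorem lie_apply (W X Y : L) :
    S.lie W X Y = S.dd W (S.g X Y) - S.g (S.br W X) Y - S.g X (S.br W Y) := rfl

theorem lie_symm (W X Y : L) : S.lie W X Y = S.lie W Y X := by
  rw [lie_apply, lie_apply, S.g_symm X Y, S.g_symm (S.br W X), S.g_symm X]; ring

/-- Polarisation: the bundle-like condition only controls the quadratic form, but the Lie derivative
of `g` is symmetric and 2 can be cancelled. -/
theorem lie_v_h_h (U X Y : L) : S.lie (S.v U) (S.h X) (S.h Y) = 0 := by
  have key : ∀ X, S.lie (S.v U) (S.h X) (S.h X) = 0 := fun X ↦ by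
    have := S.bundleLike U X
    rw [← v_apply] at this
    rw [lie_apply, this, S.g_symm (S.h X)]; ring
  have hxy := key (X + Y)
  have e : S.lie (S.v U) (S.h (X + Y)) (S.h (X + Y)) = S.lie (S.v U) (S.h X) (S.h X)
      + S.lie (S.v U) (S.h Y) (S.h Y) + 2 * S.lie (S.v U) (S.h X) (S.h Y) := by
    simp only [map_add]
    have : ∀ P, S.lie (S.v U) (S.h X + S.h Y) P
        = S.lie (S.v U) (S.h X) P + S.lie (S.v U) (S.h Y) P := fun P ↦ by
      rw [lie_symm, map_add, lie_symm, S.lie_symm _ P]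
    rw [this, this, S.lie_symm _ (S.h Y) (S.h X)]; ring
  rw [e, key, key] at hxy
  exact S.two_cancel _ (by simpa using hxy)

/-- `D` is the Levi-Civita connection and `C` is the tensor measuring the variation of the metric
of the leaves in horizontal directions. -/
structure IsConnectionPair (D C : L → L → L) : Prop where
  two_g_D : ∀ X Y Z, 2 * S.g (D X Y) Z = S.koszul X Y Z
  two_g_C : ∀ X Y Z, 2 * S.g (C X Y) Z = S.lie (S.h X) (S.v Y) (S.v Z)

/-- The fundamental connection built from `D` and `C`. -/
def nabOf (D C : L → L → L) (X Y : L) : L :=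
  S.h (D (S.h X) (S.h Y)) + S.h (S.br (S.v X) (S.h Y))
    + (S.v (S.br (S.h X) (S.v Y)) + C (S.h X) (S.v Y)) + S.v (D (S.v X) (S.v Y))

namespace IsConnectionPair

variable {S} {D C : L → L → L} (P : S.IsConnectionPair D C)
include P

theorem D_torsion_free (X Y : L) : D X Y - D Y X = S.br X Y := by
  refine S.ext_g fun Z ↦ ?_
  rw [map_sub, LinearMap.sub_apply, mul_sub, P.two_g_D, P.two_g_D, koszul_apply, koszul_apply,
    S.br_swap Y X, S.br_swap X Z, S.br_swap Z Y, S.g_symm Y X, S.g_symm Z X, S.g_symm Z Y]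
  simp only [map_neg, LinearMap.neg_apply]
  ring

theorem D_metric (X Y Z : L) : S.dd X (S.g Y Z) = S.g (D X Y) Z + S.g Y (D X Z) := by
  refine S.two_cancel' ?_
  rw [mul_add, S.g_symm Y (D X Z), P.two_g_D, P.two_g_D, koszul_apply, koszul_apply,
    S.br_swap Y X, S.br_swap Z X, S.br_swap Z Y, S.g_symm Y X, S.g_symm Z X, S.g_symm Z Y]
  simp only [map_neg, LinearMap.neg_apply]
  ring

theorem D_add_left (X X' Y : L) : D (X + X') Y = D X Y + D X' Y := by
  refine S.ext_g fun Z ↦ ?_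
  rw [map_add, LinearMap.add_apply, mul_add]
  simp only [P.two_g_D, koszul_apply, map_add, LinearMap.add_apply, AddMonoidHom.add_apply]
  ring

theorem D_smul_left (f : A) (X Y : L) : D (f • X) Y = f • D X Y := by
  refine S.ext_g fun Z ↦ ?_
  rw [map_smul, LinearMap.smul_apply, smul_eq_mul, mul_left_comm]
  simp only [P.two_g_D, koszul_apply, map_smul, LinearMap.smul_apply, smul_eq_mul, S.dd_mul,
    S.dd_smul, S.br_smul, S.br_smul_left, map_add, map_sub, LinearMap.add_apply,
    LinearMap.sub_apply]
  rw [S.g_symm Z X]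
  ring

/-- Trades the second argument of `D` for the first, so that the rules in the second argument follow
from those in the first and the rules for the bracket. -/
theorem D_eq (X Y : L) : D X Y = D Y X + S.br X Y := by rw [← P.D_torsion_free]; abel

theorem D_add_right (X Y Y' : L) : D X (Y + Y') = D X Y + D X Y' := by
  rw [P.D_eq, P.D_add_left, map_add, P.D_eq X Y, P.D_eq X Y']; abel

theorem D_smul_right (f : A) (X Y : L) : D X (f • Y) = f • D X Y + S.dd X f • Y := by
  rw [P.D_eq, P.D_smul_left, S.br_smul, P.D_eq X Y, smul_add]; abel

theorem D_zero_left (Y : L) : D 0 Y = 0 := by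
  simpa using P.D_smul_left 0 0 Y

theorem D_zero_right (Y : L) : D Y 0 = 0 := by
  have := P.D_add_right Y 0 0
  simpa using this

theorem C_add_left (X X' Y : L) : C (X + X') Y = C X Y + C X' Y := by
  refine S.ext_g fun Z ↦ ?_
  rw [map_add, LinearMap.add_apply, mul_add]
  simp only [P.two_g_C, lie_apply, map_add, LinearMap.add_apply, AddMonoidHom.add_apply]
  ring

/-- The extra terms of the Lie derivative along `f • h X` contain a product of `h X` with a vertical
field, hence vanish. -/
theorem C_smul_left (f : A) (X Y : L) : C (f • X) Y = f • C X Y := by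
  refine S.ext_g fun Z ↦ ?_
  rw [map_smul, LinearMap.smul_apply, smul_eq_mul, mul_left_comm]
  simp only [P.two_g_C, lie_apply, map_smul, LinearMap.smul_apply, smul_eq_mul,
    S.dd_smul, S.br_smul_left, map_sub, LinearMap.sub_apply, g_h_v, g_v_h]
  ring

/-- Symmetry of the Lie derivative moves `Y` into the slot where `lie` is linear by construction. -/
theorem C_add_right (X Y Y' : L) : C X (Y + Y') = C X Y + C X Y' := by
  refine S.ext_g fun Z ↦ ?_
  rw [map_add, LinearMap.add_apply, mul_add]
  simp only [P.two_g_C, S.lie_symm _ _ (S.v Z), map_add]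

theorem C_smul_right (f : A) (X Y : L) : C X (f • Y) = f • C X Y := by
  refine S.ext_g fun Z ↦ ?_
  rw [map_smul, LinearMap.smul_apply, smul_eq_mul, mul_left_comm]
  simp only [P.two_g_C, S.lie_symm _ _ (S.v Z), map_smul, smul_eq_mul]

theorem C_zero_left (Y : L) : C 0 Y = 0 := by
  simpa using P.C_smul_left 0 0 Y

theorem C_zero_right (Y : L) : C Y 0 = 0 := by
  simpa using P.C_smul_right 0 Y 0

theorem h_C (X Y : L) : S.h (C X Y) = 0 := by
  refine S.ext_g fun Z ↦ ?_
  rw [S.g_h, P.two_g_C]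
  simp

theorem C_symm (X Y Z : L) : S.g (C X (S.v Y)) (S.v Z) = S.g (C X (S.v Z)) (S.v Y) := by
  refine S.two_cancel' ?_
  rw [P.two_g_C, P.two_g_C, S.lie_symm]

theorem nab_add_left (X X' Y : L) :
    S.nabOf D C (X + X') Y = S.nabOf D C X Y + S.nabOf D C X' Y := by
  simp only [nabOf, map_add, P.D_add_left, P.C_add_left, AddMonoidHom.add_apply]
  abel

theorem nab_add_right (X Y Y' : L) :
    S.nabOf D C X (Y + Y') = S.nabOf D C X Y + S.nabOf D C X Y' := by
  simp only [nabOf, map_add, P.D_add_right, P.C_add_right]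
  abel

/-- In both bracket terms the derivative of `f` multiplies a field of the type removed by the outer
projection. -/
theorem nab_smul_left (f : A) (X Y : L) : S.nabOf D C (f • X) Y = f • S.nabOf D C X Y := by
  simp only [nabOf, map_smul, P.D_smul_left, P.C_smul_left, S.br_smul_left, map_sub, h_v, v_h,
    smul_zero, sub_zero, smul_add]

theorem nab_smul_right (f : A) (X Y : L) :
    S.nabOf D C X (f • Y) = f • S.nabOf D C X Y + S.dd X f • Y := by
  -- Each of the four pieces of the connection contributes one of the four terms of `(X f) Y`, once
  -- `X` and `Y` are split.
  conv_rhs => rw [← S.h_add_v Y, ← S.h_add_v X]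
  simp only [nabOf, map_smul, map_add, P.D_smul_right, P.C_smul_right, S.br_smul, hh_apply, v_v,
    smul_add, AddMonoidHom.add_apply, add_smul, h_v, v_h, add_zero, zero_add]
  abel

theorem h_nab (X Y : L) : S.h (S.nabOf D C X Y) = S.nabOf D C X (S.h Y) := by
  simp [nabOf, P.h_C, P.D_zero_right, P.C_zero_right]

/-- Each block is metric for its own reason: `D` is metric for the horizontal-horizontal and
vertical-vertical ones; differentiating `H` along `V` uses the bundle-like condition;
differentiating `V` along `H` works because `C` is symmetric and is half the Lie derivative of the
metric. -/
theorem nab_metric (X Y Z : L) :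
    S.dd X (S.g Y Z) = S.g (S.nabOf D C X Y) Z + S.g Y (S.nabOf D C X Z) := by
  have e1 := P.D_metric (S.h X) (S.h Y) (S.h Z)
  have e2 := S.lie_v_h_h X Y Z
  have e3 := P.two_g_C (S.h X) (S.v Y) (S.v Z)
  have e4 := P.D_metric (S.v X) (S.v Y) (S.v Z)
  have e5 := P.C_symm (S.h X) Y Z
  have e6 : S.g Y Z = S.g (S.h Y) (S.h Z) + S.g (S.v Y) (S.v Z) := by
    conv_lhs => rw [← S.h_add_v Y, ← S.h_add_v Z]
    simp
  have e7 : S.dd X = S.dd (S.h X) + S.dd (S.v X) := by rw [← map_add, S.h_add_v]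
  have e8 : ∀ Y Z, S.g (S.nabOf D C X Y) Z = S.g (D (S.h X) (S.h Y)) (S.h Z)
      + S.g (S.br (S.v X) (S.h Y)) (S.h Z) + S.g (S.br (S.h X) (S.v Y)) (S.v Z)
      + S.g (C (S.h X) (S.v Y)) (S.v Z) + S.g (D (S.v X) (S.v Y)) (S.v Z) := fun Y Z ↦ by
    have : S.g (C (S.h X) (S.v Y)) (S.v Z) = S.g (C (S.h X) (S.v Y)) Z := by
      rw [← S.g_v, v_apply _ (C _ _), P.h_C, sub_zero]
    simp only [nabOf, map_add, LinearMap.add_apply, S.g_h, S.g_v, this]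
    ring
  rw [S.g_symm Y (S.nabOf D C X Z), e8, e8, e6, e7, map_add, AddMonoidHom.add_apply,
    AddMonoidHom.add_apply]
  rw [lie_apply, S.g_symm (S.h Y) (S.br _ _)] at e2
  rw [lie_apply, hh_apply, v_v, v_v, S.g_symm (S.v Y) (S.br _ _)] at e3
  rw [S.g_symm (S.h Y) (D _ _)] at e1
  rw [S.g_symm (S.v Y) (D _ _)] at e4
  linear_combination e1 + e2 + e4 - e3 + e5

/-- The torsion of the fundamental connection. -/
def torOf : L →ₗ[A] L →ₗ[A] L :=
  LinearMap.mk₂ A (fun X Y ↦ S.nabOf D C X Y - S.nabOf D C Y X - S.br X Y)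
    (fun X X' Y ↦ by simp only [P.nab_add_left, P.nab_add_right, map_add,
      AddMonoidHom.add_apply]; abel)
    (fun f X Y ↦ by simp only [P.nab_smul_left, P.nab_smul_right, S.br_smul_left, smul_sub]; abel)
    (fun X Y Y' ↦ by simp only [P.nab_add_left, P.nab_add_right, map_add]; abel)
    (fun f X Y ↦ by simp only [P.nab_smul_left, P.nab_smul_right, S.br_smul, smul_sub]; abel)

theorem torOf_apply (X Y : L) :
    P.torOf X Y = S.nabOf D C X Y - S.nabOf D C Y X - S.br X Y := rfl

theorem torOf_swap (X Y : L) : P.torOf X Y = -P.torOf Y X := by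
  rw [torOf_apply, torOf_apply, S.br_swap X Y]; abel

/-- By involutivity the bracket is vertical, so projecting the torsion-free `D` to `V` loses
nothing. -/
theorem torOf_v_v (X Y : L) : P.torOf (S.v X) (S.v Y) = 0 := by
  have h1 := P.D_torsion_free (S.v X) (S.v Y)
  have h2 := S.h_add_v (S.br (S.v X) (S.v Y))
  rw [h_br_v_v, zero_add] at h2
  have h3 : S.v (D (S.v X) (S.v Y)) - S.v (D (S.v Y) (S.v X)) = S.br (S.v X) (S.v Y) := by
    rw [← map_sub, h1, h2]
  simp [torOf_apply, nabOf, P.D_zero_left, P.C_zero_left, h3]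

/-- The horizontal and vertical parts of the bracket occurring in the two derivatives add up to the
whole bracket, and only the correction `C` is left. -/
theorem torOf_v_h (X Y : L) : P.torOf (S.v X) (S.h Y) = -C (S.h Y) (S.v X) := by
  have h2 := S.h_add_v (S.br (S.v X) (S.h Y))
  rw [torOf_apply]
  simp only [nabOf, P.D_zero_left, P.D_zero_right, P.C_zero_left, h_v, v_h, v_v,
    hh_apply, map_zero, add_zero, zero_add]
  rw [S.br_swap (S.h Y), map_neg]
  nth_rewrite 3 [← h2]
  abel

/-- Only the horizontal part of the bracket is accounted for by `D`; the rest measures the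
non-integrability of `H`. -/
theorem torOf_h_h (X Y : L) : P.torOf (S.h X) (S.h Y) = -S.v (S.br (S.h X) (S.h Y)) := by
  have h1 := P.D_torsion_free (S.h X) (S.h Y)
  have h3 : S.h (D (S.h X) (S.h Y)) - S.h (D (S.h Y) (S.h X)) = S.h (S.br (S.h X) (S.h Y)) := by
    rw [← map_sub, h1]
  simp [torOf_apply, nabOf, P.D_zero_left, P.C_zero_right, h3, v_apply]

theorem h_torOf (X Y : L) : S.h (P.torOf X Y) = 0 := by
  rw [← S.h_add_v X, ← S.h_add_v Y]
  simp only [map_add, LinearMap.add_apply, torOf_v_v, torOf_v_h, torOf_h_h,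
    P.torOf_swap (S.h X) (S.v Y), map_neg, P.h_C, h_v]
  simp

/-- Inherited from the symmetry of `C`, the vertical part of `Y` contributing nothing. -/
theorem torOf_symm (X Y Z : L) :
    S.g (P.torOf (S.v X) Y) (S.v Z) = S.g (P.torOf (S.v Z) Y) (S.v X) := by
  rw [← S.h_add_v Y]
  simp only [map_add, LinearMap.add_apply, torOf_v_v, torOf_v_h, map_neg, LinearMap.neg_apply,
    P.C_symm _ X Z]
  simp

theorem nab_neg_right (X Y : L) : S.nabOf D C X (-Y) = -S.nabOf D C X Y := by
  have h0 : S.nabOf D C X 0 = 0 := by simpa using P.nab_add_right X 0 0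
  refine eq_neg_of_add_eq_zero_left ?_
  rw [← P.nab_add_right, neg_add_cancel, h0]

theorem nab_sub_right (X Y Z : L) :
    S.nabOf D C X (Y - Z) = S.nabOf D C X Y - S.nabOf D C X Z := by
  rw [sub_eq_add_neg, P.nab_add_right, P.nab_neg_right, ← sub_eq_add_neg]

theorem nab_neg_left (X Y : L) : S.nabOf D C (-X) Y = -S.nabOf D C X Y := by
  simpa using P.nab_smul_left (-1) X Y

/-- The curvature of the fundamental connection, bilinear in its last two arguments. -/
def riemOf (X : L) : L →ₗ[A] L →ₗ[A] L :=
  LinearMap.mk₂ A (fun Y Z ↦ S.nabOf D C X (S.nabOf D C Y Z) - S.nabOf D C Y (S.nabOf D C X Z)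
      - S.nabOf D C (S.br X Y) Z)
    (fun Y Y' Z ↦ by simp only [P.nab_add_left, P.nab_add_right, map_add]; abel)
    (fun f Y Z ↦ by
      simp only [P.nab_smul_left, P.nab_smul_right, S.br_smul, P.nab_add_left, smul_sub]; abel)
    (fun Y Z Z' ↦ by simp only [P.nab_add_right]; abel)
    (fun f Y Z ↦ by
      simp only [P.nab_smul_right, P.nab_add_right, S.dd_br, smul_sub, sub_smul]; abel)

theorem riemOf_apply (X Y Z : L) : P.riemOf X Y Z = S.nabOf D C X (S.nabOf D C Y Z)
    - S.nabOf D C Y (S.nabOf D C X Z) - S.nabOf D C (S.br X Y) Z := rfl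

theorem riemOf_swap (X Y Z : L) : P.riemOf X Y Z = -P.riemOf Y X Z := by
  rw [riemOf_apply, riemOf_apply, S.br_swap X Y, P.nab_neg_left]; abel

theorem riemOf_add (X X' Y Z : L) :
    P.riemOf (X + X') Y Z = P.riemOf X Y Z + P.riemOf X' Y Z := by
  rw [riemOf_swap, map_add, LinearMap.add_apply, P.riemOf_swap X, P.riemOf_swap X']
  simp [add_comm]

theorem h_riemOf (X Y Z : L) : S.h (P.riemOf X Y Z) = P.riemOf X Y (S.h Z) := by
  simp only [riemOf_apply, map_sub, P.h_nab]

/-- Differentiate the function `g Z W` along the bracket with a metric connection; the products of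
first derivatives cancel. -/
theorem g_riemOf (X Y Z W : L) : S.g (P.riemOf X Y Z) W = -S.g (P.riemOf X Y W) Z := by
  have e := S.dd_br X Y (S.g Z W)
  simp only [P.nab_metric, map_add] at e
  rw [S.g_symm (P.riemOf X Y W)]
  simp only [riemOf_apply, map_sub, LinearMap.sub_apply]
  linear_combination -e

theorem g_riemOf_h_v (X Y Z W : L) : S.g (P.riemOf X Y (S.h Z)) (S.v W) = 0 := by
  rw [← P.h_riemOf, g_h_v]

/-- The horizontal part of the first Bianchi identity. -/
theorem h_bianchi (X Y Z : L) :
    S.h (P.riemOf X Y Z + P.riemOf Y Z X + P.riemOf Z X Y) = 0 := by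
  -- The cyclic sum consists of derivatives of torsions, torsions with brackets, and the Jacobi
  -- expression. Torsions and their derivatives are vertical, so `h` kills everything.
  have e : P.riemOf X Y Z + P.riemOf Y Z X + P.riemOf Z X Y =
      S.nabOf D C X (P.torOf Y Z) + S.nabOf D C Y (P.torOf Z X) + S.nabOf D C Z (P.torOf X Y)
      + P.torOf X (S.br Y Z) + P.torOf Y (S.br Z X) + P.torOf Z (S.br X Y)
      + (S.br X (S.br Y Z) + S.br Y (S.br Z X) + S.br Z (S.br X Y)) := by
    simp only [riemOf_apply, torOf_apply, P.nab_sub_right]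
    abel
  have j : S.br X (S.br Y Z) + S.br Y (S.br Z X) + S.br Z (S.br X Y) = 0 := by
    rw [S.jacobi X Y Z, S.br_swap Z (S.br X Y), S.br_swap Z X, map_neg]; abel
  have n0 : ∀ X, S.nabOf D C X 0 = 0 := fun X ↦ by simpa using P.nab_add_right X 0 0
  rw [e, j]
  simp only [map_add, P.h_nab, P.h_torOf, n0, add_zero]

theorem g_bianchi (X Y Z W : L) : S.g (P.riemOf X Y Z) (S.h W) + S.g (P.riemOf Y Z X) (S.h W)
    + S.g (P.riemOf Z X Y) (S.h W) = 0 := by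
  rw [← LinearMap.add_apply, ← map_add, ← LinearMap.add_apply, ← map_add, ← S.g_h, P.h_bianchi]
  simp

/-- The classical combination of four Bianchi identities with the two skew-symmetries. All arguments
have to be horizontal, since the fields rotate through the last slot and only the horizontal part of
Bianchi is available. -/
theorem riemOf_pair_symm (X Y Z W : L) :
    S.g (P.riemOf (S.h X) (S.h Y) (S.h Z)) (S.h W)
      = S.g (P.riemOf (S.h Z) (S.h W) (S.h X)) (S.h Y) := by
  have b1 := P.g_bianchi (S.h X) (S.h Y) (S.h Z) W
  have b2 := P.g_bianchi (S.h Y) (S.h Z) (S.h W) X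
  have b3 := P.g_bianchi (S.h Z) (S.h W) (S.h X) Y
  have b4 := P.g_bianchi (S.h W) (S.h X) (S.h Y) Z
  have sw : ∀ X Y Z W, S.g (P.riemOf X Y Z) W = -S.g (P.riemOf Y X Z) W := fun X Y Z W ↦ by
    rw [P.riemOf_swap]; simp
  refine S.two_cancel' ?_
  generalize S.h X = X at *
  generalize S.h Y = Y at *
  generalize S.h Z = Z at *
  generalize S.h W = W at *
  linear_combination b1 + b2 - b3 - b4 - sw Z X Y W - P.g_riemOf Y Z W X - P.g_riemOf Z W Y X
    - sw W Y Z X + P.g_riemOf Y W Z X + sw W X Z Y - P.g_riemOf X W Z Y + P.g_riemOf X Z W Y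
    + sw W X Y Z + P.g_riemOf X Y W Z

/-- In the Bianchi identity the term with `U` in the last slot of the curvature is vertical, so the
expression is symmetric in `X, Y`. It is also skew in `Y, Z`, and a trilinear form with both
properties is zero. -/
theorem g_riemOf_v_h_h (U X Y Z : L) :
    S.g (P.riemOf (S.v U) (S.h X) (S.h Y)) (S.h Z) = 0 := by
  have sy : ∀ X Y Z, S.g (P.riemOf (S.v U) (S.h X) (S.h Y)) (S.h Z)
      = S.g (P.riemOf (S.v U) (S.h Y) (S.h X)) (S.h Z) := fun X Y Z ↦ by
    have b := P.g_bianchi (S.v U) (S.h X) (S.h Y) Z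
    have z : S.g (P.riemOf (S.h X) (S.h Y) (S.v U)) (S.h Z) = 0 := by
      rw [← S.g_h, P.h_riemOf]; simp
    rw [z, P.riemOf_swap (S.h Y)] at b
    simp only [map_neg, LinearMap.neg_apply] at b
    linear_combination b
  have an := fun X Y Z ↦ P.g_riemOf (S.v U) (S.h X) (S.h Y) (S.h Z)
  refine S.two_cancel _ ?_
  linear_combination sy X Y Z + an Y X Z - sy Y Z X - an Z Y X + sy Z X Y + an X Z Y

/-- The covariant derivative of the torsion, bilinear in its first two arguments. -/
def nabTorOf (U : L) : L →ₗ[A] L →ₗ[A] L :=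
  LinearMap.mk₂ A (fun X Y ↦ S.nabOf D C X (P.torOf Y U) - P.torOf (S.nabOf D C X Y) U
      - P.torOf Y (S.nabOf D C X U))
    (fun X X' Y ↦ by simp only [P.nab_add_left, map_add, LinearMap.add_apply]; abel)
    (fun f X Y ↦ by simp only [P.nab_smul_left, map_smul, LinearMap.smul_apply, smul_sub])
    (fun X Y Y' ↦ by simp only [P.nab_add_right, map_add, LinearMap.add_apply]; abel)
    (fun f X Y ↦ by
      simp only [P.nab_smul_right, map_smul, map_add, LinearMap.add_apply, LinearMap.smul_apply,
        smul_sub]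
      abel)

theorem nabTorOf_apply (U X Y : L) : P.nabTorOf U X Y =
    S.nabOf D C X (P.torOf Y U) - P.torOf (S.nabOf D C X Y) U - P.torOf Y (S.nabOf D C X U) := rfl

theorem nabTorOf_add (U U' X Y : L) :
    P.nabTorOf (U + U') X Y = P.nabTorOf U X Y + P.nabTorOf U' X Y := by
  simp only [nabTorOf_apply, map_add, P.nab_add_right]; abel

theorem g_nabTorOf_h (U X Y W : L) : S.g (P.nabTorOf U X Y) (S.h W) = 0 := by
  have n0 : ∀ X, S.nabOf D C X 0 = 0 := fun X ↦ by simpa using P.nab_add_right X 0 0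
  rw [← S.g_h, nabTorOf_apply]
  simp [P.h_nab, P.h_torOf, n0]

theorem v_nab (X Y : L) : S.v (S.nabOf D C X Y) = S.nabOf D C X (S.v Y) := by
  rw [v_apply, v_apply, P.nab_sub_right, P.h_nab]

theorem torOf_symm' (X Y Z : L) :
    S.g (P.torOf Y (S.v X)) (S.v Z) = S.g (P.torOf Y (S.v Z)) (S.v X) := by
  rw [P.torOf_swap Y, P.torOf_swap Y]
  simp [P.torOf_symm X]

/-- Differentiate the symmetry of `Tor(Y, ·)` on `V`; this stays inside `V` because the connection
is metric and preserves the splitting. -/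
theorem g_nabTorOf_symm (U V X Y : L) :
    S.g (P.nabTorOf (S.v U) X Y) (S.v V) = S.g (P.nabTorOf (S.v V) X Y) (S.v U) := by
  have m1 := P.nab_metric X (P.torOf Y (S.v U)) (S.v V)
  have m2 := P.nab_metric X (P.torOf Y (S.v V)) (S.v U)
  have s1 := P.torOf_symm' U (S.nabOf D C X Y) V
  have s2 := P.torOf_symm' U Y V
  have s3 := P.torOf_symm' U Y (S.nabOf D C X V)
  have s4 := P.torOf_symm' V Y (S.nabOf D C X U)
  rw [P.v_nab] at s3 s4
  rw [s2] at m1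
  simp only [nabTorOf_apply, map_sub, LinearMap.sub_apply]
  linear_combination m2 - m1 - s1 - s3 + s4

/-- The summand of `𝔯(U, V)`, polarised in the horizontal field, where `j U X` stands for the
endomorphism `J_U` applied to `X` and `q` stands for `1 / 4`. -/
def frakROf (q : A) (j : L → L →ₗ[A] L) (U V : L) : L →ₗ[A] L →ₗ[A] A :=
  (P.riemOf U).compr₂ (S.g.flip V) - (P.nabTorOf U).compr₂ (S.g.flip V)
    - (P.torOf.comp (P.torOf U)).compr₂ (S.g.flip V)
    + q • S.g.compl₁₂ (S.h ∘ₗ j U) (S.h ∘ₗ j V)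
    - S.g.compl₁₂ (P.torOf.flip U) (P.torOf.flip V)

theorem frakROf_apply (q : A) (j : L → L →ₗ[A] L) (U V X Y : L) : P.frakROf q j U V X Y =
    S.g (P.riemOf U X Y) V - S.g (P.nabTorOf U X Y) V - S.g (P.torOf (P.torOf U X) Y) V
      + q * S.g (S.h (j U X)) (S.h (j V Y)) - S.g (P.torOf X U) (P.torOf Y V) := rfl

theorem g_torOf_h (X Y Z : L) : S.g (P.torOf X Y) (S.h Z) = 0 := by
  rw [← S.g_h, P.h_torOf]; simp

theorem v_torOf (X Y : L) : S.v (P.torOf X Y) = P.torOf X Y := by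
  rw [v_apply, P.h_torOf, sub_zero]

theorem g_torOf_swap (X Y U V : L) :
    S.g (P.torOf X U) (P.torOf Y V) = S.g (P.torOf U X) (P.torOf V Y) := by
  rw [P.torOf_swap X, P.torOf_swap Y]; simp

/-- The inner torsion is vertical, so `torOf_symm` applies. This is where the second copy of `(Tor,
Tor)` in the blocks with vertical second argument comes from. -/
theorem g_torOf_torOf (V X Y Z : L) :
    S.g (P.torOf (P.torOf X Y) Z) (S.v V) = S.g (P.torOf X Y) (P.torOf (S.v V) Z) := by
  rw [← P.v_torOf X Y, P.torOf_symm, S.g_symm]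

/-- An operation `j` with `⟨j U X, Y⟩ = ⟨U, Tor(X, Y)⟩` is linear in `X`. -/
def linearOf (j : L → L → L) (hj : ∀ U X Y, S.g (j U X) Y = S.g U (P.torOf X Y)) (U : L) :
    L →ₗ[A] L where
  toFun := j U
  map_add' X X' := S.ext_g fun Z ↦ by simp [hj]
  map_smul' f X := S.ext_g fun Z ↦ by simp [hj]

variable {q : A} {j : L → L →ₗ[A] L} (hj : ∀ U X Y, S.g (j U X) Y = S.g U (P.torOf X Y))
include hj

theorem j_h (U X : L) : j (S.h U) X = 0 := by
  refine S.ext_g fun Z ↦ ?_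
  rw [hj, S.g_h, P.h_torOf]; simp

theorem j_add (U U' X : L) : j (U + U') X = j U X + j U' X := by
  refine S.ext_g fun Z ↦ ?_
  simp [hj]

theorem frakROf_add_left (U U' V X Y : L) :
    P.frakROf q j (U + U') V X Y = P.frakROf q j U V X Y + P.frakROf q j U' V X Y := by
  simp only [frakROf_apply, P.riemOf_add, P.nabTorOf_add, P.j_add hj, map_add,
    LinearMap.add_apply]
  ring

theorem frakROf_add_right (U V V' X Y : L) :
    P.frakROf q j U (V + V') X Y = P.frakROf q j U V X Y + P.frakROf q j U V' X Y := by
  simp only [frakROf_apply, P.j_add hj, map_add]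
  ring

/-- The two middle torsion terms are vertical and paired with a horizontal field, and `J` vanishes
for a horizontal index. -/
theorem frakROf_h_h (X Y e : L) : P.frakROf q j (S.h X) (S.h Y) (S.h e) (S.h e) =
    S.g (P.riemOf (S.h X) (S.h e) (S.h e)) (S.h Y)
      - S.g (P.torOf (S.h X) (S.h e)) (P.torOf (S.h Y) (S.h e)) := by
  rw [frakROf_apply, P.g_nabTorOf_h, P.g_torOf_h, P.j_h hj, P.g_torOf_swap]
  simp

theorem frakROf_h_h_symm (X Y e : L) : P.frakROf q j (S.h X) (S.h Y) (S.h e) (S.h e) =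
    P.frakROf q j (S.h Y) (S.h X) (S.h e) (S.h e) := by
  rw [P.frakROf_h_h hj, P.frakROf_h_h hj, S.g_symm (P.torOf (S.h X) (S.h e)),
    P.riemOf_pair_symm X e e Y, P.riemOf_swap (S.h e) (S.h Y), P.g_riemOf (S.h Y), map_neg,
    LinearMap.neg_apply, P.g_riemOf (S.h Y) (S.h e) (S.h X)]

/-- As in the horizontal block, and the curvature term also vanishes, by `g_riemOf_v_h_h`. -/
theorem frakROf_v_h (U X e : L) : P.frakROf q j (S.v U) (S.h X) (S.h e) (S.h e) =
    -S.g (P.torOf (S.v U) (S.h e)) (P.torOf (S.h X) (S.h e)) := by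
  rw [frakROf_apply, P.g_nabTorOf_h, P.g_torOf_h, P.j_h hj, P.g_torOf_swap, P.g_riemOf_v_h_h]
  simp

/-- Here the curvature term is horizontal and paired with a vertical field, while the iterated
torsion survives and doubles the last term. -/
theorem frakROf_h_v (U X e : L) : P.frakROf q j (S.h X) (S.v U) (S.h e) (S.h e) =
    -S.g (P.nabTorOf (S.h X) (S.h e) (S.h e)) (S.v U)
      - 2 * S.g (P.torOf (S.v U) (S.h e)) (P.torOf (S.h X) (S.h e)) := by
  rw [frakROf_apply, P.g_riemOf_h_v, P.g_torOf_torOf, P.j_h hj, P.g_torOf_swap (S.h e) (S.h e),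
    S.g_symm (P.torOf (S.v U) (S.h e))]
  simp
  ring

omit hj in
theorem frakROf_v_v (U V e : L) : P.frakROf q j (S.v U) (S.v V) (S.h e) (S.h e) =
    -S.g (P.nabTorOf (S.v U) (S.h e) (S.h e)) (S.v V)
      + q * S.g (S.h (j (S.v U) (S.h e))) (S.h (j (S.v V) (S.h e)))
      - 2 * S.g (P.torOf (S.v U) (S.h e)) (P.torOf (S.v V) (S.h e)) := by
  rw [frakROf_apply, P.g_riemOf_h_v, P.g_torOf_torOf, P.g_torOf_swap (S.h e) (S.h e)]
  ring

omit hj in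
theorem frakROf_v_v_symm (U V e : L) : P.frakROf q j (S.v U) (S.v V) (S.h e) (S.h e) =
    P.frakROf q j (S.v V) (S.v U) (S.h e) (S.h e) := by
  rw [frakROf_v_v, frakROf_v_v, P.g_nabTorOf_symm U, S.g_symm (S.h _) (S.h _),
    S.g_symm (P.torOf (S.v U) _)]

end IsConnectionPair

end FoliatedAlgebroid

/-! ### Calculus of smooth fields on open sets -/

section SmoothFields

variable {E : Type*} [NormedAddCommGroup E] [NormedSpace ℝ E]
  {M : Type*} [TopologicalSpace M] [ChartedSpace E M]

/-- `f` is a smooth function on `s`. -/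
abbrev SmoothFunOn (E : Type*) [NormedAddCommGroup E] [NormedSpace ℝ E] {M : Type*}
    [TopologicalSpace M] [ChartedSpace E M] (s : Set M) (f : M → ℝ) : Prop :=
  ContMDiffOn 𝓘(ℝ, E) 𝓘(ℝ) ∞ f s

theorem SmoothFunOn.mdifferentiableAt {s : Set M} {f : M → ℝ} (hf : SmoothFunOn E s f)
    (hs : IsOpen s) {y : M} (hy : y ∈ s) : MDifferentiableAt 𝓘(ℝ, E) 𝓘(ℝ) f y :=
  (hf.contMDiffAt (hs.mem_nhds hy)).mdifferentiableAt (by simp)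

variable [IsManifold 𝓘(ℝ, E) ∞ M]

theorem SmoothFieldOn.contMDiffAt {s : Set M} {X : VField E M} (hX : SmoothFieldOn s X)
    (hs : IsOpen s) {y : M} (hy : y ∈ s) : ContMDiffAt 𝓘(ℝ, E) (𝓘(ℝ, E).prod 𝓘(ℝ, E)) ∞
    (fun x ↦ (⟨x, X x⟩ : TangentBundle 𝓘(ℝ, E) M)) y :=
  ContMDiffOn.contMDiffAt hX (hs.mem_nhds hy)

theorem SmoothFieldOn.mdifferentiableAt {s : Set M} {X : VField E M} (hX : SmoothFieldOn s X)
    (hs : IsOpen s) {y : M} (hy : y ∈ s) :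
    MDifferentiableAt 𝓘(ℝ, E) (𝓘(ℝ, E).prod 𝓘(ℝ, E))
      (fun x ↦ (⟨x, X x⟩ : TangentBundle 𝓘(ℝ, E) M)) y :=
  (hX.contMDiffAt hs hy).mdifferentiableAt (by simp)

theorem SmoothFieldOn.mono {s t : Set M} {X : VField E M} (hX : SmoothFieldOn s X)
    (h : t ⊆ s) : SmoothFieldOn t X := ContMDiffOn.mono hX h

theorem SmoothFieldOn.congr {s : Set M} {X Y : VField E M} (hX : SmoothFieldOn s X)
    (h : ∀ y ∈ s, Y y = X y) : SmoothFieldOn s Y :=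
  ContMDiffOn.congr hX fun y hy ↦ by rw [h y hy]

theorem SmoothField.smoothFieldOn {X : VField E M} (hX : SmoothField X) (s : Set M) :
    SmoothFieldOn s X := ContMDiff.contMDiffOn hX

theorem smoothFieldOn_zero (s : Set M) : SmoothFieldOn s (0 : VField E M) :=
  (contMDiff_zeroSection ℝ (TangentSpace 𝓘(ℝ, E) (M := M))).contMDiffOn

theorem SmoothFieldOn.add {s : Set M} {X Y : VField E M} (hX : SmoothFieldOn s X)
    (hY : SmoothFieldOn s Y) : SmoothFieldOn s (X + Y) := ContMDiffOn.add_section hX hY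

theorem SmoothFieldOn.sub {s : Set M} {X Y : VField E M} (hX : SmoothFieldOn s X)
    (hY : SmoothFieldOn s Y) : SmoothFieldOn s (X - Y) := ContMDiffOn.sub_section hX hY

theorem SmoothFieldOn.smul {s : Set M} {f : M → ℝ} {X : VField E M} (hf : SmoothFunOn E s f)
    (hX : SmoothFieldOn s X) : SmoothFieldOn s (f • X) := ContMDiffOn.smul_section hf hX

theorem SmoothFieldOn.sum {ι : Type*} [Fintype ι] {s : Set M} {X : ι → VField E M}
    (hX : ∀ i, SmoothFieldOn s (X i)) : SmoothFieldOn s (fun y ↦ ∑ i, X i y) :=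
  ContMDiffOn.sum_section fun i _ ↦ hX i

theorem SmoothFieldOn.dirDeriv {s : Set M} (hs : IsOpen s) {X : VField E M} {f : M → ℝ}
    (hX : SmoothFieldOn s X) (hf : SmoothFunOn E s f) : SmoothFunOn E s (dirDeriv X f) := by
  -- The derivative along `X` is the fibre component of the tangent map of `f` composed with the
  -- section `X`.
  have h1 := ContMDiffOn.contMDiffOn_tangentMapWithin (m := ∞) hf (by simp) hs.uniqueMDiffOn
  have h2 := h1.comp hX (fun y hy ↦ hy)
  intro y hy
  have h3 := (Bundle.contMDiffWithinAt_totalSpace.1 (h2 y hy)).2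
  refine h3.congr_of_mem (fun z hz ↦ ?_) hy
  simp [_root_.dirDeriv, mvfderiv, tangentMapWithin, mfderivWithin_of_isOpen hs hz]
  rfl

theorem SmoothFieldOn.bracket [FiniteDimensional ℝ E] {s : Set M} (hs : IsOpen s)
    {X Y : VField E M} (hX : SmoothFieldOn s X) (hY : SmoothFieldOn s Y) :
    SmoothFieldOn s (bracket X Y) := by
  have : CompleteSpace E := FiniteDimensional.complete ℝ E
  have : IsManifold 𝓘(ℝ, E) (((⊤ : ℕ∞) : WithTop ℕ∞) + 1) M := by simpa
  have : IsManifold 𝓘(ℝ, E) (minSmoothness ℝ 2) M := by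
    rw [minSmoothness_of_isRCLikeNormedField]; infer_instance
  intro y hy
  refine ContMDiffAt.contMDiffWithinAt ?_
  exact ContMDiffAt.mlieBracket_vectorField (m := ⊤) (n := ⊤) (hX.contMDiffAt hs hy)
    (hY.contMDiffAt hs hy) (by simp)

omit [IsManifold 𝓘(ℝ, E) ∞ M] in
theorem Filter.EventuallyEq.dirDeriv_eq {X X' : VField E M} {f f' : M → ℝ} {y : M}
    (hX : X y = X' y) (hf : f =ᶠ[nhds y] f') : dirDeriv X f y = dirDeriv X' f' y := by
  unfold dirDeriv mvfderiv
  rw [hX, hf.mfderiv_eq, hf.self_of_nhds]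

omit [IsManifold 𝓘(ℝ, E) ∞ M] in
theorem Filter.EventuallyEq.bracket_eq {X X' Y Y' : VField E M} {y : M}
    (hX : X =ᶠ[nhds y] X') (hY : Y =ᶠ[nhds y] Y') : bracket X Y y = bracket X' Y' y :=
  hX.mlieBracket_vectorField_eq hY

omit [IsManifold 𝓘(ℝ, E) ∞ M] in
theorem dirDeriv_add_field (X Y : VField E M) (f : M → ℝ) (y : M) :
    dirDeriv (X + Y) f y = dirDeriv X f y + dirDeriv Y f y := by
  simp [dirDeriv]

omit [IsManifold 𝓘(ℝ, E) ∞ M] in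
theorem dirDeriv_smul_field (a : M → ℝ) (X : VField E M) (f : M → ℝ) (y : M) :
    dirDeriv (a • X) f y = a y * dirDeriv X f y := by
  simp [dirDeriv]

omit [IsManifold 𝓘(ℝ, E) ∞ M] in
theorem dirDeriv_add (X : VField E M) {f f' : M → ℝ} {y : M}
    (hf : MDifferentiableAt 𝓘(ℝ, E) 𝓘(ℝ) f y) (hf' : MDifferentiableAt 𝓘(ℝ, E) 𝓘(ℝ) f' y) :
    dirDeriv X (f + f') y = dirDeriv X f y + dirDeriv X f' y := by
  simp [dirDeriv, mvfderiv_add hf hf']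

omit [IsManifold 𝓘(ℝ, E) ∞ M] in
theorem dirDeriv_mul (X : VField E M) {f f' : M → ℝ} {y : M}
    (hf : MDifferentiableAt 𝓘(ℝ, E) 𝓘(ℝ) f y) (hf' : MDifferentiableAt 𝓘(ℝ, E) 𝓘(ℝ) f' y) :
    dirDeriv X (f * f') y = f y * dirDeriv X f' y + dirDeriv X f y * f' y := by
  simp [dirDeriv, mvfderiv_mul hf hf', mul_comm]

theorem bracket_smul_right [FiniteDimensional ℝ E] (X : VField E M) {s : Set M} (hs : IsOpen s)
    {f : M → ℝ} {Y : VField E M} (hf : SmoothFunOn E s f) (hY : SmoothFieldOn s Y) {y : M}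
    (hy : y ∈ s) :
    bracket X (f • Y) y = dirDeriv X f y • Y y + f y • bracket X Y y :=
  have : CompleteSpace E := FiniteDimensional.complete ℝ E
  VectorField.mlieBracket_smul_right (hf.mdifferentiableAt hs hy) (hY.mdifferentiableAt hs hy)

theorem bracket_add_right [FiniteDimensional ℝ E] (X : VField E M) {s : Set M} (hs : IsOpen s)
    {Y Y' : VField E M} (hY : SmoothFieldOn s Y) (hY' : SmoothFieldOn s Y') {y : M}
    (hy : y ∈ s) : bracket X (Y + Y') y = bracket X Y y + bracket X Y' y :=
  have : CompleteSpace E := FiniteDimensional.complete ℝ E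
  VectorField.mlieBracket_add_right (hY.mdifferentiableAt hs hy) (hY'.mdifferentiableAt hs hy)

omit [IsManifold 𝓘(ℝ, E) ∞ M] in
theorem bracket_swap (X Y : VField E M) (y : M) : bracket X Y y = -bracket Y X y :=
  VectorField.mlieBracket_swap_apply

theorem exists_smoothFieldOn_extendVec {x : M} (w : TangentSpace 𝓘(ℝ, E) x) :
    ∃ t : Set M, IsOpen t ∧ x ∈ t ∧ SmoothFieldOn t (extendVec w) := by
  obtain ⟨s, hs, h⟩ := FiberBundle.exists_contMDiffOn_extend (k := ∞) 𝓘(ℝ, E) E w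
  obtain ⟨t, ht, hto, hx⟩ := mem_nhds_iff.1 hs
  exact ⟨t, hto, hx, ContMDiffOn.mono h ht⟩

theorem extendVec_self {x : M} (w : TangentSpace 𝓘(ℝ, E) x) : extendVec w x = w :=
  FiberBundle.extend_apply_self E w

/-- An extended vector is constant in the trivialization at `x`, so over the base set its values are
images of the original vectors under linear isomorphisms. -/
theorem exists_linearIndependent_extendVec {x : M} {ι : Type*}
    {w : ι → TangentSpace 𝓘(ℝ, E) x} (hw : LinearIndependent ℝ w) :
    ∃ t : Set M, IsOpen t ∧ x ∈ t ∧ (∀ i, SmoothFieldOn t (extendVec (w i))) ∧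
      ∀ y ∈ t, LinearIndependent ℝ (fun i ↦ extendVec (w i) y) := by
  let e := trivializationAt E (TangentSpace 𝓘(ℝ, E) (M := M)) x
  have hx : x ∈ e.baseSet := FiberBundle.mem_baseSet_trivializationAt' x
  refine ⟨e.baseSet, e.open_baseSet, hx, fun i ↦ ?_, fun y hy ↦ ?_⟩
  · have : ContMDiffOn 𝓘(ℝ, E) 𝓘(ℝ, E) ∞ (fun _ : M ↦ (e ⟨x, w i⟩).2) e.baseSet :=
      contMDiffOn_const
    intro y hy
    rw [e.contMDiffWithinAt_section _ hy]
    refine (this.congr fun z hz ↦ ?_) y hy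
    exact (congrArg Prod.snd (e.apply_mk_symm hz (e ⟨x, w i⟩).2) :)
  · have h1 := hw.map' (e.linearEquivAt ℝ x hx).toLinearMap (LinearEquiv.ker _)
    have h2 := h1.map' (e.linearEquivAt ℝ y hy).symm.toLinearMap (LinearEquiv.ker _)
    convert! h2 using 1

theorem bracket_jacobi [FiniteDimensional ℝ E] {s : Set M} (hs : IsOpen s) {X Y Z : VField E M}
    (hX : SmoothFieldOn s X) (hY : SmoothFieldOn s Y) (hZ : SmoothFieldOn s Z) {y : M}
    (hy : y ∈ s) : bracket X (bracket Y Z) y =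
      bracket (bracket X Y) Z y + bracket Y (bracket X Z) y := by
  have : CompleteSpace E := FiniteDimensional.complete ℝ E
  have : IsManifold 𝓘(ℝ, E) (minSmoothness ℝ 3) M := by
    rw [minSmoothness_of_isRCLikeNormedField]; infer_instance
  have h2 : minSmoothness ℝ 2 ≤ ∞ := by
    rw [minSmoothness_of_isRCLikeNormedField]; exact ENat.LEInfty.out
  exact VectorField.leibniz_identity_mlieBracket_apply ((hX.contMDiffAt hs hy).of_le h2)
    ((hY.contMDiffAt hs hy).of_le h2) ((hZ.contMDiffAt hs hy).of_le h2)

/-- The value of `[X, Y]` on functions. -/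
theorem dirDeriv_bracket [FiniteDimensional ℝ E] {s : Set M} (hs : IsOpen s) {X Y : VField E M}
    {f : M → ℝ} (hX : SmoothFieldOn s X) (hY : SmoothFieldOn s Y) (hf : SmoothFunOn E s f) {y : M}
    (hy : y ∈ s) : dirDeriv (bracket X Y) f y =
      dirDeriv X (dirDeriv Y f) y - dirDeriv Y (dirDeriv X f) y := by
  rcases subsingleton_or_nontrivial (TangentSpace 𝓘(ℝ, E) y) with h | h
  · simp [dirDeriv, Subsingleton.elim (_ : TangentSpace 𝓘(ℝ, E) y) 0]
  -- The formula is read off from the Jacobi identity for `X`, `Y` and `f • Z`, where `Z` extends a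
  -- nonzero vector: after the Leibniz rule and the Jacobi identity for `X`, `Y`, `Z`, what remains
  -- is the desired difference times `Z y`.
  obtain ⟨w, hw⟩ := exists_ne (0 : TangentSpace 𝓘(ℝ, E) y)
  obtain ⟨t', ht', hyt', hZ'⟩ := exists_smoothFieldOn_extendVec w
  set Z := extendVec w
  have hZy : Z y = w := extendVec_self w
  set t := s ∩ t'
  have ht : IsOpen t := hs.inter ht'
  have hyt : y ∈ t := ⟨hy, hyt'⟩
  replace hX := hX.mono (inter_subset_left : t ⊆ s)
  replace hY := hY.mono (inter_subset_left : t ⊆ s)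
  replace hf : SmoothFunOn E t f := ContMDiffOn.mono hf inter_subset_left
  have hZ := hZ'.mono (inter_subset_right : t ⊆ t')
  have second : ∀ {U V : VField E M}, SmoothFieldOn t U → SmoothFieldOn t V →
      bracket U (bracket V (f • Z)) y = dirDeriv U (dirDeriv V f) y • Z y
        + dirDeriv V f y • bracket U Z y + dirDeriv U f y • bracket V Z y
        + f y • bracket U (bracket V Z) y := fun {U V} hU hV ↦ by
    have e : bracket V (f • Z) =ᶠ[nhds y] dirDeriv V f • Z + f • bracket V Z := by
      filter_upwards [ht.mem_nhds hyt] with z hz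
      exact bracket_smul_right V ht hf hZ hz
    rw [Filter.EventuallyEq.rfl.bracket_eq e, bracket_add_right U ht
      (SmoothFieldOn.smul (hV.dirDeriv ht hf) hZ) (SmoothFieldOn.smul hf (hV.bracket ht hZ)) hyt,
      bracket_smul_right U ht (hV.dirDeriv ht hf) hZ hyt,
      bracket_smul_right U ht hf (hV.bracket ht hZ) hyt]
    abel
  have key := bracket_jacobi ht hX hY (SmoothFieldOn.smul hf hZ) hyt
  rw [second hX hY, second hY hX, bracket_smul_right _ ht hf hZ hyt, bracket_jacobi ht hX hY hZ hyt] at key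
  have : (dirDeriv (bracket X Y) f y - (dirDeriv X (dirDeriv Y f) y
      - dirDeriv Y (dirDeriv X f) y)) • w = 0 := by
    rw [← hZy]
    linear_combination (norm := module) (-1 : ℝ) • key
  exact sub_eq_zero.1 ((smul_eq_zero.1 this).resolve_right hw)

end SmoothFields

/-! ### Smooth coefficients in a frame -/

section Metric

variable {E : Type*} [NormedAddCommGroup E] [NormedSpace ℝ E]
  {M : Type*} [TopologicalSpace M] [ChartedSpace E M] [IsManifold 𝓘(ℝ, E) ∞ M]
  [RiemannianBundle (fun x : M ↦ TangentSpace 𝓘(ℝ, E) x)]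
  
theorem SmoothFieldOn.metric [IsContMDiffRiemannianBundle 𝓘(ℝ, E) ∞ E (fun x : M ↦ TangentSpace 𝓘(ℝ, E) x)] {s : Set M} {X Y : VField E M} (hX : SmoothFieldOn s X)
    (hY : SmoothFieldOn s Y) : SmoothFunOn E s (metric X Y) :=
  ContMDiffOn.inner_bundle hX hY

/-- A field with smooth inner products with a frame of a subbundle in which it lies is a smooth
combination of the frame. -/
theorem exists_smooth_coeff [IsContMDiffRiemannianBundle 𝓘(ℝ, E) ∞ E (fun x : M ↦ TangentSpace 𝓘(ℝ, E) x)] {ι : Type*} [Fintype ι] {s : Set M} {Z : ι → VField E M}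
    (hZ : ∀ i, SmoothFieldOn s (Z i)) (hli : ∀ y ∈ s, LinearIndependent ℝ (fun i ↦ Z i y))
    {W : VField E M} (hW : ∀ y ∈ s, W y ∈ Submodule.span ℝ (range fun i ↦ Z i y))
    (hWZ : ∀ i, SmoothFunOn E s (metric W (Z i))) :
    ∃ c : ι → M → ℝ, (∀ i, SmoothFunOn E s (c i)) ∧ ∀ y ∈ s, W y = ∑ i, c i y • Z i y := by
  classical
  -- Cramer's rule for the Gram matrix: its determinant and adjugate are polynomials in smooth inner
  -- products, and linear independence makes the determinant nonzero.
  let G : M → Matrix ι ι ℝ := fun y ↦ Matrix.gram ℝ fun i ↦ Z i y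
  have hG : ∀ i j, SmoothFunOn E s fun y ↦ G y i j := fun i j ↦ (hZ i).metric (hZ j)
  have hdet : ∀ G : M → Matrix ι ι ℝ, (∀ i j, SmoothFunOn E s fun y ↦ G y i j) →
      SmoothFunOn E s fun y ↦ (G y).det := fun G hG ↦ by
    simp only [Matrix.det_apply, Units.smul_def, zsmul_eq_mul]
    exact contMDiffOn_finsetSum fun σ _ ↦
      contMDiffOn_const.mul (contMDiffOn_finsetProd fun i _ ↦ hG _ _)
  have hadj : ∀ i j, SmoothFunOn E s fun y ↦ (G y).adjugate i j := fun i j ↦ by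
    simp only [Matrix.adjugate_apply]
    refine hdet _ fun k l ↦ ?_
    simp only [Matrix.updateRow_apply]
    split_ifs
    · exact contMDiffOn_const
    · exact hG k l
  have hne : ∀ y ∈ s, (G y).det ≠ 0 := fun y hy ↦
    Matrix.det_gram_ne_zero_iff_linearIndependent.2 (hli y hy)
  refine ⟨fun i y ↦ ((G y).det)⁻¹ * ∑ j, (G y).adjugate i j * metric W (Z j) y, fun i ↦ ?_, ?_⟩
  · refine ContMDiffOn.mul ((hdet G hG).inv₀ hne) (contMDiffOn_finsetSum fun j _ ↦ ?_)
    exact (hadj i j).mul (hWZ j)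
  · intro y hy
    obtain ⟨a, ha⟩ := (Submodule.mem_span_range_iff_exists_fun ℝ).1 (hW y hy)
    have hb : ∀ j, metric W (Z j) y = (G y).mulVec a j := fun j ↦ by
      simp [_root_.metric, ← ha, sum_inner, G, inner_smul_left, Matrix.mulVec, dotProduct,
        real_inner_comm, mul_comm]
    have : ∀ i, ((G y).det)⁻¹ * ∑ j, (G y).adjugate i j * metric W (Z j) y = a i := fun i ↦ by
      have h1 : ∑ j, (G y).adjugate i j * metric W (Z j) y
          = ((G y).adjugate.mulVec ((G y).mulVec a)) i := by
        simp only [hb]; rfl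
      rw [h1, Matrix.mulVec_mulVec, Matrix.adjugate_mul, Matrix.smul_mulVec, Matrix.one_mulVec]
      simp [hne y hy]
    simp only [this, ha]

end Metric

/-! ### Smoothness of the horizontal and vertical projections -/

section Projections

variable {E : Type*} [NormedAddCommGroup E] [NormedSpace ℝ E] [FiniteDimensional ℝ E]
  {M : Type*} [TopologicalSpace M] [ChartedSpace E M] [IsManifold 𝓘(ℝ, E) ∞ M]
  [RiemannianBundle (fun x : M ↦ TangentSpace 𝓘(ℝ, E) x)]
  {m : ℕ} (F : Foliation E M m)

namespace Foliation

theorem hor_add_ver (X : VField E M) (y : M) : F.hor X y + F.ver X y = X y := by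
  rw [add_comm]
  exact Submodule.starProjection_add_starProjection_orthogonal (K := F.V y) (X y)

theorem ver_eq (X : VField E M) (y : M) : F.ver X y = X y - F.hor X y := by
  rw [← F.hor_add_ver X y]; abel

theorem hor_mem (X : VField E M) (y : M) : F.hor X y ∈ F.H y :=
  Submodule.starProjection_apply_mem _ _

theorem ver_mem (X : VField E M) (y : M) : F.ver X y ∈ F.V y :=
  Submodule.starProjection_apply_mem _ _

theorem hor_eq_self {X : VField E M} {y : M} (h : X y ∈ F.H y) : F.hor X y = X y :=
  Submodule.starProjection_eq_self_iff.2 h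

theorem ver_eq_self {X : VField E M} {y : M} (h : X y ∈ F.V y) : F.ver X y = X y :=
  Submodule.starProjection_eq_self_iff.2 h

theorem hor_eq_zero {X : VField E M} {y : M} (h : X y ∈ F.V y) : F.hor X y = 0 := by
  have := F.hor_add_ver X y
  rwa [F.ver_eq_self h, add_eq_right] at this

theorem metric_hor (X Y : VField E M) (y : M) :
    metric (F.hor X) Y y = metric X (F.hor Y) y :=
  Submodule.inner_starProjection_left_eq_right _ _ _

theorem metric_ver_of_mem (X : VField E M) {Y : VField E M} {y : M} (hY : Y y ∈ F.V y) :
    metric (F.ver X) Y y = metric X Y y := by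
  have h : metric (F.ver X) Y y = metric X (F.ver Y) y :=
    Submodule.inner_starProjection_left_eq_right _ _ _
  rw [h, metric, metric, F.ver_eq_self hY]

/-- Against a vertical frame, `ver X` has the same inner products as `X`, so they are smooth and
`exists_smooth_coeff` applies. -/
theorem smoothFieldOn_ver
    [IsContMDiffRiemannianBundle 𝓘(ℝ, E) ∞ E (fun x : M ↦ TangentSpace 𝓘(ℝ, E) x)]
    {s : Set M} (hs : IsOpen s) {X : VField E M} (hX : SmoothFieldOn s X) :
    SmoothFieldOn s (F.ver X) := by
  intro y hy
  obtain ⟨u, hu, hyu, Z, hZ, hspan⟩ := F.exists_local_frame y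
  have hX' := hX.mono (inter_subset_left : s ∩ u ⊆ s)
  have hZ' := fun i ↦ (hZ i).mono (inter_subset_right : s ∩ u ⊆ u)
  have mem : ∀ z ∈ s ∩ u, ∀ i, Z i z ∈ F.V z := fun z hz i ↦ by
    rw [← (hspan z hz.2).2]; exact Submodule.subset_span ⟨i, rfl⟩
  obtain ⟨c, hc, hcZ⟩ := exists_smooth_coeff (W := F.ver X) hZ' (fun z hz ↦ (hspan z hz.2).1)
    (fun z hz ↦ by rw [(hspan z hz.2).2]; exact F.ver_mem X z)
    (fun i ↦ (hX'.metric (hZ' i)).congr fun z hz ↦ F.metric_ver_of_mem X (mem z hz i))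
  have : SmoothFieldOn (s ∩ u) (F.ver X) :=
    (SmoothFieldOn.sum fun i ↦ SmoothFieldOn.smul (hc i) (hZ' i)).congr hcZ
  exact (this.contMDiffAt (hs.inter hu) ⟨hy, hyu⟩).contMDiffWithinAt

theorem smoothFieldOn_hor
    [IsContMDiffRiemannianBundle 𝓘(ℝ, E) ∞ E (fun x : M ↦ TangentSpace 𝓘(ℝ, E) x)]
    {s : Set M} (hs : IsOpen s) {X : VField E M} (hX : SmoothFieldOn s X) :
    SmoothFieldOn s (F.hor X) :=
  (hX.sub (F.smoothFieldOn_ver hs hX)).congr fun y _ ↦ by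
    rw [Pi.sub_apply, F.ver_eq]; abel

end Foliation

end Projections

/-! ### The algebroid of fields on an open set -/

section FieldOn

variable {E : Type*} [NormedAddCommGroup E] [NormedSpace ℝ E]
  {M : Type*} [TopologicalSpace M] [ChartedSpace E M] [IsManifold 𝓘(ℝ, E) ∞ M]

variable (E) in
/-- The functions which are smooth on the open set `s`. -/
def smoothFunSubalgebra (s : Opens M) : Subalgebra ℝ (M → ℝ) where
  carrier := {f | SmoothFunOn E (s : Set M) f}
  mul_mem' hf hg := ContMDiffOn.mul hf hg
  add_mem' hf hg := ContMDiffOn.add hf hg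
  algebraMap_mem' _ := contMDiffOn_const

variable (E) in
/-- The vector fields which are smooth on the open set `s` and vanish outside of it. -/
def smoothFieldSubmodule (s : Opens M) : Submodule (smoothFunSubalgebra E s) (VField E M) where
  carrier := {X | SmoothFieldOn (s : Set M) X ∧ ∀ y ∉ s, X y = 0}
  add_mem' hX hY := ⟨hX.1.add hY.1, fun y hy ↦ by rw [Pi.add_apply, hX.2 y hy, hY.2 y hy, add_zero]⟩
  zero_mem' := ⟨smoothFieldOn_zero _, fun _ _ ↦ rfl⟩
  smul_mem' f X hX := ⟨SmoothFieldOn.smul f.2 hX.1, fun y hy ↦ by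
    change f.1 y • X y = 0
    rw [hX.2 y hy, smul_zero]⟩

variable (E) in
/-- The ring of functions which are smooth on `s`. -/
def FunOn (s : Opens M) : Type _ := smoothFunSubalgebra E s

variable (E) in
/-- The module of vector fields which are smooth on `s` and vanish outside of it. -/
def FieldOn (s : Opens M) : Type _ := smoothFieldSubmodule E s

noncomputable instance (s : Opens M) : CommRing (FunOn E s) :=
  inferInstanceAs (CommRing (smoothFunSubalgebra E s))

noncomputable instance (s : Opens M) : AddCommGroup (FieldOn E s) :=
  inferInstanceAs (AddCommGroup (smoothFieldSubmodule E s))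

noncomputable instance (s : Opens M) : Module (FunOn E s) (FieldOn E s) :=
  inferInstanceAs (Module (smoothFunSubalgebra E s) (smoothFieldSubmodule E s))

namespace FunOn

variable {s : Opens M}

/-- The underlying function. -/
def val (f : FunOn E s) : M → ℝ := f.1

omit [IsManifold 𝓘(ℝ, E) ∞ M] in
theorem smooth (f : FunOn E s) : SmoothFunOn E (s : Set M) f.val := f.2

-- Elements of `FunOn` are unrestricted outside `s`, so identities between them must also be checked
-- there. This succeeds because metric products and derivatives along elements of `FieldOn` vanish
-- off `s`.
omit [IsManifold 𝓘(ℝ, E) ∞ M] in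
theorem ext' {f g : FunOn E s} (h : ∀ y, f.val y = g.val y) : f = g :=
  Subtype.ext (funext h)

omit [IsManifold 𝓘(ℝ, E) ∞ M] in
theorem val_add (f g : FunOn E s) : (f + g).val = f.val + g.val := rfl

omit [IsManifold 𝓘(ℝ, E) ∞ M] in
theorem val_mul (f g : FunOn E s) : (f * g).val = f.val * g.val := rfl

omit [IsManifold 𝓘(ℝ, E) ∞ M] in
theorem val_sub (f g : FunOn E s) : (f - g).val = f.val - g.val := rfl

/-- The constant functions. -/
def const (s : Opens M) (c : ℝ) : FunOn E s := ⟨fun _ ↦ c, contMDiffOn_const⟩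

end FunOn

namespace FieldOn

variable {s : Opens M}

/-- The underlying vector field. -/
def val (X : FieldOn E s) : VField E M := X.1

theorem smooth (X : FieldOn E s) : SmoothFieldOn (s : Set M) X.val := X.2.1

theorem val_eq_zero (X : FieldOn E s) {y : M} (hy : y ∉ s) : X.val y = 0 := X.2.2 y hy

theorem val_smul (f : FunOn E s) (X : FieldOn E s) : (f • X).val = f.val • X.val := rfl

theorem val_add (X Y : FieldOn E s) : (X + Y).val = X.val + Y.val := rfl

theorem val_neg (X : FieldOn E s) : (-X).val = -X.val := rfl

/-- The purpose of requiring the fields to vanish off `s`: their values on `s` determine them. -/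
theorem ext_on {X Y : FieldOn E s} (h : ∀ y ∈ s, X.val y = Y.val y) : X = Y := by
  refine Subtype.ext (funext fun y ↦ ?_)
  by_cases hy : y ∈ s
  · exact h y hy
  · exact (X.val_eq_zero hy).trans (Y.val_eq_zero hy).symm

open Classical in
/-- The field on `s` which agrees on `s` with a given smooth field. -/
noncomputable def of (X : VField E M) (hX : SmoothFieldOn (s : Set M) X) : FieldOn E s :=
  ⟨fun y ↦ if y ∈ s then X y else 0, hX.congr fun _ hy ↦ if_pos hy, fun _ hy ↦ if_neg hy⟩

theorem of_val {X : VField E M} (hX : SmoothFieldOn (s : Set M) X) {y : M} (hy : y ∈ s) :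
    (of X hX).val y = X y := if_pos hy

theorem dirDeriv_eq_zero (X : FieldOn E s) (f : M → ℝ) {y : M} (hy : y ∉ s) :
    dirDeriv X.val f y = 0 := by
  rw [dirDeriv, X.val_eq_zero hy, map_zero]

theorem of_eventuallyEq {X : VField E M} (hX : SmoothFieldOn (s : Set M) X) {y : M} (hy : y ∈ s) :
    (of X hX).val =ᶠ[nhds y] X :=
  Filter.eventually_of_mem (s.isOpen.mem_nhds hy) fun _ hz ↦ of_val hX hz

end FieldOn

variable [FiniteDimensional ℝ E]
  [RiemannianBundle (fun x : M ↦ TangentSpace 𝓘(ℝ, E) x)]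
  [IsContMDiffRiemannianBundle 𝓘(ℝ, E) ∞ E (fun x : M ↦ TangentSpace 𝓘(ℝ, E) x)]
  {m : ℕ}

/-- The fields on an open set of a foliated manifold with bundle-like metric. -/
noncomputable def Foliation.algebroid (F : Foliation E M m) (hF : F.IsBundleLike) (s : Opens M) :
    FoliatedAlgebroid (FunOn E s) (FieldOn E s) where
  br := AddMonoidHom.mk' (fun X ↦ AddMonoidHom.mk'
      (fun Y ↦ FieldOn.of (bracket X.val Y.val) (X.smooth.bracket s.isOpen Y.smooth))
      (fun Y Y' ↦ FieldOn.ext_on fun y hy ↦ by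
        simp only [FieldOn.val_add, Pi.add_apply, FieldOn.of_val _ hy]
        exact bracket_add_right _ s.isOpen Y.smooth Y'.smooth hy))
    (fun X X' ↦ by
      ext1 Y
      refine FieldOn.ext_on fun y hy ↦ ?_
      simp only [AddMonoidHom.mk'_apply, AddMonoidHom.add_apply, FieldOn.val_add, Pi.add_apply,
        FieldOn.of_val _ hy]
      rw [bracket_swap, bracket_add_right _ s.isOpen X.smooth X'.smooth hy, bracket_swap,
        bracket_swap _ X'.val]
      abel)
  dd := AddMonoidHom.mk' (fun X ↦ AddMonoidHom.mk'
      (fun a ↦ (⟨dirDeriv X.val a.val, X.smooth.dirDeriv s.isOpen a.smooth⟩ : FunOn E s))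
      (fun a b ↦ FunOn.ext' fun y ↦ by
        change dirDeriv X.val (a.val + b.val) y = dirDeriv X.val a.val y + dirDeriv X.val b.val y
        by_cases hy : y ∈ s
        · exact dirDeriv_add _ (a.smooth.mdifferentiableAt s.isOpen hy)
            (b.smooth.mdifferentiableAt s.isOpen hy)
        · simp [X.dirDeriv_eq_zero _ hy]))
    (fun X X' ↦ by ext1 a; exact FunOn.ext' fun y ↦ dirDeriv_add_field _ _ _ _)
  g := LinearMap.mk₂ _
    (fun X Y ↦ (⟨metric X.val Y.val, X.smooth.metric Y.smooth⟩ : FunOn E s))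
    (fun X X' Y ↦ FunOn.ext' fun y ↦ inner_add_left _ _ _)
    (fun f X Y ↦ FunOn.ext' fun y ↦ real_inner_smul_left _ _ _)
    (fun X Y Y' ↦ FunOn.ext' fun y ↦ inner_add_right _ _ _)
    (fun f X Y ↦ FunOn.ext' fun y ↦ real_inner_smul_right _ _ _)
  h :=
    { toFun := fun X ↦ ⟨F.hor X.val, F.smoothFieldOn_hor s.isOpen X.smooth, fun y hy ↦ by
        rw [Foliation.hor, X.val_eq_zero hy, map_zero]⟩
      map_add' := fun X Y ↦ FieldOn.ext_on fun y _ ↦ map_add _ _ _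
      map_smul' := fun f X ↦ FieldOn.ext_on fun y _ ↦ map_smul _ _ _ }
  two_cancel a h := FunOn.ext' fun y ↦ by
    have := congrFun (congrArg FunOn.val h) y
    exact (mul_eq_zero.1 this).resolve_left two_ne_zero
  br_swap X Y := FieldOn.ext_on fun y hy ↦ by
    simp only [AddMonoidHom.mk'_apply, FieldOn.of_val _ hy, FieldOn.val_neg, Pi.neg_apply]
    exact bracket_swap _ _ _
  br_smul X f Y := FieldOn.ext_on fun y hy ↦ by
    simp only [AddMonoidHom.mk'_apply, FieldOn.of_val _ hy, FieldOn.val_add, Pi.add_apply,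
      FieldOn.val_smul]
    rw [bracket_smul_right _ s.isOpen f.smooth Y.smooth hy, Pi.smul_apply', Pi.smul_apply',
      FieldOn.of_val _ hy]
    rfl
  jacobi X Y Z := FieldOn.ext_on fun y hy ↦ by
    simp only [AddMonoidHom.mk'_apply, FieldOn.of_val _ hy, FieldOn.val_add, Pi.add_apply]
    exact (Filter.EventuallyEq.rfl.bracket_eq (FieldOn.of_eventuallyEq _ hy)).trans
      ((bracket_jacobi s.isOpen X.smooth Y.smooth Z.smooth hy).trans (congrArg₂ (· + ·)
        ((FieldOn.of_eventuallyEq _ hy).bracket_eq Filter.EventuallyEq.rfl).symm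
        (Filter.EventuallyEq.rfl.bracket_eq (FieldOn.of_eventuallyEq _ hy)).symm))
  dd_smul f X a := FunOn.ext' fun y ↦ dirDeriv_smul_field _ _ _ _
  dd_mul X a b := FunOn.ext' fun y ↦ by
    change dirDeriv X.val (a.val * b.val) y
      = a.val y * dirDeriv X.val b.val y + dirDeriv X.val a.val y * b.val y
    by_cases hy : y ∈ s
    · exact dirDeriv_mul _ (a.smooth.mdifferentiableAt s.isOpen hy)
        (b.smooth.mdifferentiableAt s.isOpen hy)
    · simp [X.dirDeriv_eq_zero _ hy]
  dd_br X Y a := FunOn.ext' fun y ↦ by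
    change dirDeriv (FieldOn.val _) a.val y = dirDeriv X.val (dirDeriv Y.val a.val) y
      - dirDeriv Y.val (dirDeriv X.val a.val) y
    by_cases hy : y ∈ s
    · rw [← dirDeriv_bracket s.isOpen X.smooth Y.smooth a.smooth hy]
      exact Filter.EventuallyEq.dirDeriv_eq
        (FieldOn.of_val (X.smooth.bracket s.isOpen Y.smooth) hy) Filter.EventuallyEq.rfl
    · simp [FieldOn.dirDeriv_eq_zero _ _ hy]
  g_symm X Y := FunOn.ext' fun y ↦ real_inner_comm _ _
  g_nondeg X h := FieldOn.ext_on fun y _ ↦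
    inner_self_eq_zero.1 (congrFun (congrArg FunOn.val h) y)
  h_h X := FieldOn.ext_on fun y _ ↦ F.hor_eq_self (F.hor_mem _ y)
  g_h X Y := FunOn.ext' fun y ↦ F.metric_hor _ _ _
  involutive X Y := FieldOn.ext_on fun y hy ↦ by
    refine F.hor_eq_zero ?_
    have mem : ∀ (X : FieldOn E s) (z : M), X.val z - F.hor X.val z ∈ F.V z := fun X z ↦ by
      rw [← F.ver_eq]; exact F.ver_mem _ _
    have := F.involutive s _ _ s.isOpen (X.smooth.sub (F.smoothFieldOn_hor s.isOpen X.smooth))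
      (Y.smooth.sub (F.smoothFieldOn_hor s.isOpen Y.smooth)) (fun z _ ↦ mem X z)
      (fun z _ ↦ mem Y z) y hy
    simp only [AddMonoidHom.mk'_apply, FieldOn.of_val _ hy]
    exact this
  bundleLike U X := FunOn.ext' fun y ↦ by
    by_cases hy : y ∈ s
    · have mem : ∀ (X : FieldOn E s) (z : M), X.val z - F.hor X.val z ∈ F.V z := fun X z ↦ by
        rw [← F.ver_eq]; exact F.ver_mem _ _
      have := hF s _ _ s.isOpen (U.smooth.sub (F.smoothFieldOn_hor s.isOpen U.smooth))
        (F.smoothFieldOn_hor s.isOpen X.smooth) (fun z _ ↦ mem U z) (fun z _ ↦ F.hor_mem _ z) y hy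
      -- On the diagonal the two bracket terms of the Lie derivative coincide.
      rw [lieMetric, metric, metric, real_inner_comm, sub_sub, sub_eq_zero, ← two_mul] at this
      refine this.trans (congrArg (2 * ·) ?_)
      exact (real_inner_comm _ _).trans (congrArg (fun w ↦ inner ℝ w (F.hor X.val y))
        (FieldOn.of_val ((U.smooth.sub (F.smoothFieldOn_hor s.isOpen U.smooth)).bracket s.isOpen
          (F.smoothFieldOn_hor s.isOpen X.smooth)) hy).symm)
    · refine (FieldOn.dirDeriv_eq_zero _ _ hy).trans (mul_eq_zero_of_right _ ?_).symm
      change inner ℝ (FieldOn.val _ y) _ = _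
      rw [FieldOn.val_eq_zero _ hy, inner_zero_left]

end FieldOn

/-! ### Dependence on germs only -/

section Locality

variable {E : Type*} [NormedAddCommGroup E] [NormedSpace ℝ E]
  {M : Type*} [TopologicalSpace M] [ChartedSpace E M] [IsManifold 𝓘(ℝ, E) ∞ M]
  [RiemannianBundle (fun x : M ↦ TangentSpace 𝓘(ℝ, E) x)]

omit [IsManifold 𝓘(ℝ, E) ∞ M] in
theorem Filter.EventuallyEq.metric {X X' Y Y' : VField E M} {y : M} (hX : X =ᶠ[nhds y] X')
    (hY : Y =ᶠ[nhds y] Y') : metric X Y =ᶠ[nhds y] metric X' Y' := by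
  filter_upwards [hX, hY] with z h1 h2
  rw [_root_.metric, _root_.metric, h1, h2]

omit [IsManifold 𝓘(ℝ, E) ∞ M] in
theorem metric_congr_at {X X' Y Y' : VField E M} {y : M} (hX : X y = X' y) (hY : Y y = Y' y) :
    metric X Y y = metric X' Y' y := by
  rw [metric, metric, hX, hY]

variable [FiniteDimensional ℝ E]

theorem raise_congr {φ φ' : VField E M → M → ℝ} {y : M} (h : ∀ Z, φ Z y = φ' Z y) :
    raise φ y = raise φ' y := by
  simp only [raise, h]

/-- No smoothness is needed: every term of Koszul's formula depends on germs, for each fixed test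
field `Z`. -/
theorem Filter.EventuallyEq.leviCivita_eq {X X' Y Y' : VField E M} {y : M}
    (hX : X =ᶠ[nhds y] X') (hY : Y =ᶠ[nhds y] Y') :
    leviCivita X Y y = leviCivita X' Y' y := by
  have r : ∀ Z : VField E M, Z =ᶠ[nhds y] Z := fun Z ↦ Filter.EventuallyEq.rfl
  refine raise_congr fun Z ↦ ?_
  rw [dirDeriv_eq hX.self_of_nhds (hY.metric (r Z)), dirDeriv_eq hY.self_of_nhds ((r Z).metric hX),
    dirDeriv_eq rfl (hX.metric hY), metric_congr_at (hX.bracket_eq hY) rfl,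
    metric_congr_at (hY.bracket_eq (r Z)) hX.self_of_nhds,
    metric_congr_at ((r Z).bracket_eq hX) hY.self_of_nhds]

namespace Foliation

variable {m : ℕ} (F : Foliation E M m)

theorem hor_eventuallyEq {X X' : VField E M} {y : M} (hX : X =ᶠ[nhds y] X') :
    F.hor X =ᶠ[nhds y] F.hor X' := by
  filter_upwards [hX] with z hz
  rw [hor, hor, hz]

theorem ver_eventuallyEq {X X' : VField E M} {y : M} (hX : X =ᶠ[nhds y] X') :
    F.ver X =ᶠ[nhds y] F.ver X' := by
  filter_upwards [hX] with z hz
  rw [ver, ver, hz]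

theorem C_congr {X X' Y Y' : VField E M} {y : M}
    (hX : X =ᶠ[nhds y] X') (hY : Y =ᶠ[nhds y] Y') : F.C X Y y = F.C X' Y' y := by
  refine raise_congr fun Z ↦ ?_
  have r : F.ver Z =ᶠ[nhds y] F.ver Z := Filter.EventuallyEq.rfl
  have hX' := F.hor_eventuallyEq hX
  have hY' := F.ver_eventuallyEq hY
  rw [lieMetric, lieMetric, Filter.EventuallyEq.dirDeriv_eq hX'.self_of_nhds (hY'.metric r),
    metric_congr_at (hX'.bracket_eq hY') rfl,
    metric_congr_at hY'.self_of_nhds (hX'.bracket_eq r)]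

theorem nabla_congr {X X' Y Y' : VField E M} {y : M}
    (hX : X =ᶠ[nhds y] X') (hY : Y =ᶠ[nhds y] Y') : F.nabla X Y y = F.nabla X' Y' y := by
  have a := F.hor_eventuallyEq hX
  have b := F.hor_eventuallyEq hY
  have c := F.ver_eventuallyEq hX
  have d := F.ver_eventuallyEq hY
  simp only [nabla, Pi.add_apply]
  rw [F.C_congr a d]
  simp only [hor, ver] at a b c d ⊢
  rw [a.leviCivita_eq b, c.bracket_eq b, a.bracket_eq d, c.leviCivita_eq d]

theorem Tor_congr {X X' Y Y' : VField E M} {y : M}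
    (hX : X =ᶠ[nhds y] X') (hY : Y =ᶠ[nhds y] Y') : F.Tor X Y y = F.Tor X' Y' y := by
  simp only [Tor, Pi.sub_apply]
  rw [F.nabla_congr hX hY, F.nabla_congr hY hX, hX.bracket_eq hY]

theorem J_congr {Z Z' X X' : VField E M} {y : M}
    (hZ : Z =ᶠ[nhds y] Z') (hX : X =ᶠ[nhds y] X') : F.J Z X y = F.J Z' X' y := by
  exact raise_congr fun Y ↦
    metric_congr_at hZ.self_of_nhds (F.Tor_congr hX Filter.EventuallyEq.rfl)

end Foliation

end Locality

/-! ### Representing fields, and vector fields defined by duality -/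

section Representation

variable {E : Type*} [NormedAddCommGroup E] [NormedSpace ℝ E]
  {M : Type*} [TopologicalSpace M] [ChartedSpace E M] [IsManifold 𝓘(ℝ, E) ∞ M]
  {s : Opens M}

/-- The element `X'` of `FieldOn E s` represents the vector field `X` on `s`. -/
def FieldOn.Rep (X' : FieldOn E s) (X : VField E M) : Prop := ∀ y ∈ s, X'.val y = X y

/-- The element `f'` of `FunOn E s` represents the function `f` on `s`. -/
def FunOn.Rep (f' : FunOn E s) (f : M → ℝ) : Prop := ∀ y ∈ s, f'.val y = f y

theorem FieldOn.of_rep {X : VField E M} (hX : SmoothFieldOn (s : Set M) X) :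
    (FieldOn.of X hX).Rep X := fun _ hy ↦ FieldOn.of_val hX hy

theorem FieldOn.rep_self (X : FieldOn E s) : X.Rep X.val := fun _ _ ↦ rfl

omit [IsManifold 𝓘(ℝ, E) ∞ M] in
theorem FunOn.Rep.eventuallyEq {f' : FunOn E s} {f : M → ℝ} (h : f'.Rep f) {y : M} (hy : y ∈ s) :
    f'.val =ᶠ[nhds y] f := Filter.eventually_of_mem (s.isOpen.mem_nhds hy) h

omit [IsManifold 𝓘(ℝ, E) ∞ M] in
theorem FunOn.Rep.add {f' g' : FunOn E s} {f g : M → ℝ} (hf : f'.Rep f) (hg : g'.Rep g) :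
    (f' + g').Rep fun y ↦ f y + g y := fun y hy ↦ congrArg₂ (· + ·) (hf y hy) (hg y hy)

omit [IsManifold 𝓘(ℝ, E) ∞ M] in
theorem FunOn.Rep.sub {f' g' : FunOn E s} {f g : M → ℝ} (hf : f'.Rep f) (hg : g'.Rep g) :
    (f' - g').Rep fun y ↦ f y - g y := fun y hy ↦ congrArg₂ (· - ·) (hf y hy) (hg y hy)

omit [IsManifold 𝓘(ℝ, E) ∞ M] in
theorem FunOn.Rep.const_mul {f' : FunOn E s} {f : M → ℝ} (hf : f'.Rep f) (c : ℝ) :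
    (FunOn.const s c * f').Rep fun y ↦ c * f y := fun y hy ↦ congrArg (c * ·) (hf y hy)

namespace FieldOn.Rep

variable {X' Y' : FieldOn E s} {X Y : VField E M}

theorem eventuallyEq (h : X'.Rep X) {y : M} (hy : y ∈ s) : X'.val =ᶠ[nhds y] X :=
  Filter.eventually_of_mem (s.isOpen.mem_nhds hy) h

theorem add (hX : X'.Rep X) (hY : Y'.Rep Y) : (X' + Y').Rep (X + Y) := fun y hy ↦
  congrArg₂ (· + ·) (hX y hy) (hY y hy)

theorem sub (hX : X'.Rep X) (hY : Y'.Rep Y) : (X' - Y').Rep (X - Y) := fun y hy ↦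
  congrArg₂ (· - ·) (hX y hy) (hY y hy)

theorem unique (hX : X'.Rep X) (hY : Y'.Rep X) : X' = Y' :=
  FieldOn.ext_on fun y hy ↦ (hX y hy).trans (hY y hy).symm

end FieldOn.Rep

theorem FieldOn.val_sum {ι : Type*} (t : Finset ι) (X : ι → FieldOn E s) (y : M) :
    (∑ i ∈ t, X i).val y = ∑ i ∈ t, (X i).val y := by
  classical
  induction t using Finset.induction_on with
  | empty => rfl
  | insert i t hi ih => rw [Finset.sum_insert hi, Finset.sum_insert hi, FieldOn.val_add,
      Pi.add_apply, ih]

omit [IsManifold 𝓘(ℝ, E) ∞ M] in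
theorem FunOn.val_sum {ι : Type*} (t : Finset ι) (f : ι → FunOn E s) (y : M) :
    (∑ i ∈ t, f i).val y = ∑ i ∈ t, (f i).val y := by
  classical
  induction t using Finset.induction_on with
  | empty => rfl
  | insert i t hi ih => rw [Finset.sum_insert hi, Finset.sum_insert hi, FunOn.val_add,
      Pi.add_apply, ih]

variable [FiniteDimensional ℝ E]
  [RiemannianBundle (fun x : M ↦ TangentSpace 𝓘(ℝ, E) x)]
  [IsContMDiffRiemannianBundle 𝓘(ℝ, E) ∞ E (fun x : M ↦ TangentSpace 𝓘(ℝ, E) x)]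

/-- The extensions entering `raise φ` change with the base point, so not even its smoothness is
evident. Duality at `y` comes from expanding the test field in the frame extended from `y` and using
linearity of `φ`. Then `raise φ` has smooth inner products with a local frame, hence is smooth.
Linearity is asked on all smaller open sets because the frames exist only there. -/
theorem raise_spec {φ : VField E M → M → ℝ}
    (hφ : ∀ t : Opens M, t ≤ s → ∃ Φ : FieldOn E t →ₗ[FunOn E t] FunOn E t,
      ∀ (Z' : FieldOn E t) (Z : VField E M), Z'.Rep Z → (Φ Z').Rep (φ Z)) :
    SmoothFieldOn (s : Set M) (raise φ) ∧ ∀ Z : VField E M, SmoothFieldOn (s : Set M) Z →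
      ∀ y ∈ s, metric (raise φ) Z y = φ Z y := by
  -- Used twice: with `W` the test field to prove duality, and with `W = raise φ` to prove
  -- smoothness.
  have frame : ∀ (r : Opens M) (y : M), y ∈ r → ∃ t : Opens M, t ≤ r ∧ y ∈ t ∧ ∀ W : VField E M,
      let e := fun k ↦ extendVec (stdOrthonormalBasis ℝ (TangentSpace 𝓘(ℝ, E) y) k)
      (∀ k, SmoothFieldOn (t : Set M) (e k)) ∧
      ((∀ k, SmoothFunOn E (t : Set M) (metric W (e k))) → ∃ c : _ → M → ℝ,
        (∀ k, SmoothFunOn E (t : Set M) (c k)) ∧ ∀ z ∈ t, W z = ∑ k, c k z • e k z) := by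
    intro r y hy
    let b := stdOrthonormalBasis ℝ (TangentSpace 𝓘(ℝ, E) y)
    obtain ⟨u, hu, hyu, hsm, hli⟩ :=
      exists_linearIndependent_extendVec b.toBasis.linearIndependent
    simp only [OrthonormalBasis.coe_toBasis] at hsm hli
    refine ⟨r ⊓ ⟨u, hu⟩, inf_le_left, ⟨hy, hyu⟩, fun W ↦ ?_⟩
    have hsm' : ∀ k, SmoothFieldOn ((r ⊓ ⟨u, hu⟩ : Opens M) : Set M) (extendVec (b k)) :=
      fun k ↦ (hsm k).mono inter_subset_right
    refine ⟨hsm', fun hW ↦ exists_smooth_coeff hsm' (fun z hz ↦ hli z hz.2) (fun z hz ↦ ?_) hW⟩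
    rw [(hli z hz.2).span_eq_top_of_card_eq_finrank']
    · trivial
    · simp; rfl
  have spec : ∀ r : Opens M, r ≤ s → ∀ Z : VField E M, SmoothFieldOn (r : Set M) Z →
      ∀ y ∈ r, metric (raise φ) Z y = φ Z y := by
    intro r hr Z hZ y hy
    obtain ⟨t, htr, hyt, h⟩ := frame r y hy
    obtain ⟨hsm, h⟩ := h Z
    obtain ⟨c, hc, hZc⟩ := h fun k ↦ (hZ.mono htr).metric (hsm k)
    obtain ⟨Φ, hΦ⟩ := hφ t (htr.trans hr)
    set b := stdOrthonormalBasis ℝ (TangentSpace 𝓘(ℝ, E) y)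
    let B := fun k ↦ FieldOn.of _ (hsm k)
    let c' : _ → FunOn E t := fun k ↦ ⟨c k, hc k⟩
    have hZ' : (∑ k, c' k • B k).Rep Z := fun z hz ↦ by
      rw [hZc z hz, FieldOn.val_sum]
      refine Finset.sum_congr rfl fun k _ ↦ ?_
      exact congrArg (c k z • ·) (FieldOn.of_val (hsm k) hz)
    have h1 : φ Z y = ∑ k, c k y * φ (extendVec (b k)) y := by
      rw [← hΦ _ _ hZ' y hyt, map_sum, FunOn.val_sum]
      refine Finset.sum_congr rfl fun k _ ↦ ?_
      rw [map_smul]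
      exact congrArg (c k y * ·) (hΦ _ _ (FieldOn.of_rep (hsm k)) y hyt)
    -- The extended frame is orthonormal only at `y`, which suffices to read off the coefficients at
    -- `y`.
    have h2 : ∀ k, inner ℝ (b k) (Z y) = c k y := fun k ↦ by
      rw [hZc y hyt]
      simp only [extendVec_self]
      exact b.orthonormal.inner_right_fintype _ k
    rw [h1, metric, raise, sum_inner]
    refine Finset.sum_congr rfl fun k _ ↦ ?_
    rw [real_inner_smul_left, h2, mul_comm]
  refine ⟨fun y hy ↦ ?_, spec s le_rfl⟩
  obtain ⟨t, hts, hyt, h⟩ := frame s y hy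
  obtain ⟨hsm, h⟩ := h (raise φ)
  obtain ⟨Φ, hΦ⟩ := hφ t hts
  obtain ⟨c, hc, hW⟩ := h fun k ↦
    ((Φ (FieldOn.of _ (hsm k))).smooth).congr fun z hz ↦ by
      rw [spec t hts _ (hsm k) z hz, hΦ _ _ (FieldOn.of_rep (hsm k)) z hz]
  have : SmoothFieldOn (t : Set M) (raise φ) :=
    (SmoothFieldOn.sum fun k ↦ SmoothFieldOn.smul (hc k) (hsm k)).congr hW
  exact (this.contMDiffAt t.isOpen hyt).contMDiffWithinAt

end Representation

/-! ### Transfer of the operations between the manifold and the algebroid -/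

section Transfer

variable {E : Type*} [NormedAddCommGroup E] [NormedSpace ℝ E] [FiniteDimensional ℝ E]
  {M : Type*} [TopologicalSpace M] [ChartedSpace E M] [IsManifold 𝓘(ℝ, E) ∞ M]
  [RiemannianBundle (fun x : M ↦ TangentSpace 𝓘(ℝ, E) x)]
  [IsContMDiffRiemannianBundle 𝓘(ℝ, E) ∞ E (fun x : M ↦ TangentSpace 𝓘(ℝ, E) x)]
  {m : ℕ} {F : Foliation E M m} (hF : F.IsBundleLike) {s : Opens M}

namespace FieldOn.Rep

variable {X' Y' Z' : FieldOn E s} {X Y Z : VField E M}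

theorem hor (hX : X'.Rep X) : ((F.algebroid hF s).h X').Rep (F.hor X) := fun y hy ↦ by
  change F.hor X'.val y = _
  rw [Foliation.hor, Foliation.hor, hX y hy]

theorem ver (hX : X'.Rep X) : ((F.algebroid hF s).v X').Rep (F.ver X) := fun y hy ↦ by
  rw [F.ver_eq, ← hX y hy, ← hX.hor hF y hy]
  rfl

theorem bracket (hX : X'.Rep X) (hY : Y'.Rep Y) :
    ((F.algebroid hF s).br X' Y').Rep (bracket X Y) := fun _ hy ↦
  (FieldOn.of_val (X'.smooth.bracket s.isOpen Y'.smooth) hy).trans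
    ((hX.eventuallyEq hy).bracket_eq (hY.eventuallyEq hy))

theorem metric (hX : X'.Rep X) (hY : Y'.Rep Y) :
    ((F.algebroid hF s).g X' Y').Rep (metric X Y) := fun y hy ↦
  metric_congr_at (hX y hy) (hY y hy)

theorem dirDeriv (hX : X'.Rep X) {f' : FunOn E s} {f : M → ℝ} (hf : f'.Rep f) :
    ((F.algebroid hF s).dd X' f').Rep (dirDeriv X f) := fun y hy ↦
  Filter.EventuallyEq.dirDeriv_eq (hX y hy) (hf.eventuallyEq hy)

theorem koszul (hX : X'.Rep X) (hY : Y'.Rep Y) (hZ : Z'.Rep Z) :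
    ((F.algebroid hF s).koszul X' Y' Z').Rep fun x ↦
      _root_.dirDeriv X (_root_.metric Y Z) x + _root_.dirDeriv Y (_root_.metric Z X) x
      - _root_.dirDeriv Z (_root_.metric X Y) x + _root_.metric (_root_.bracket X Y) Z x
      - _root_.metric (_root_.bracket Y Z) X x + _root_.metric (_root_.bracket Z X) Y x :=
  (((((hX.dirDeriv hF (hY.metric hF hZ)).add (hY.dirDeriv hF (hZ.metric hF hX))).sub
    (hZ.dirDeriv hF (hX.metric hF hY))).add ((hX.bracket hF hY).metric hF hZ)).sub
    ((hY.bracket hF hZ).metric hF hX)).add ((hZ.bracket hF hX).metric hF hY)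

theorem lie (hX : X'.Rep X) (hY : Y'.Rep Y) (hZ : Z'.Rep Z) :
    ((F.algebroid hF s).lie X' Y' Z').Rep (lieMetric X Y Z) :=
  ((hX.dirDeriv hF (hY.metric hF hZ)).sub ((hX.bracket hF hY).metric hF hZ)).sub
    (hY.metric hF (hX.bracket hF hZ))

end FieldOn.Rep

theorem g_val_of_notMem (X Y : FieldOn E s) {y : M} (hy : y ∉ s) :
    ((F.algebroid hF s).g X Y).val y = 0 := by
  change inner ℝ (X.val y) _ = _
  rw [X.val_eq_zero hy, inner_zero_left]

theorem dd_val_of_notMem (X : FieldOn E s) (f : FunOn E s) {y : M} (hy : y ∉ s) :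
    ((F.algebroid hF s).dd X f).val y = 0 := X.dirDeriv_eq_zero _ hy

-- On each smaller open set the defining expression is half of the linear form `koszul`, so
-- `raise_spec` applies.
include hF in
theorem leviCivita_spec {X Y : VField E M} (hX : SmoothFieldOn (s : Set M) X)
    (hY : SmoothFieldOn (s : Set M) Y) : SmoothFieldOn (s : Set M) (leviCivita X Y) ∧
    ∀ Z : VField E M, SmoothFieldOn (s : Set M) Z → ∀ y ∈ s, metric (leviCivita X Y) Z y =
      (1 / 2 : ℝ) * (dirDeriv X (metric Y Z) y + dirDeriv Y (metric Z X) y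
        - dirDeriv Z (metric X Y) y + metric (bracket X Y) Z y - metric (bracket Y Z) X y
        + metric (bracket Z X) Y y) :=
  raise_spec fun t ht ↦ ⟨(FunOn.const t (1 / 2) : FunOn E t) • (F.algebroid hF t).koszul
      (FieldOn.of X (hX.mono ht)) (FieldOn.of Y (hY.mono ht)), fun _ _ hZ ↦ by
    rw [LinearMap.smul_apply]
    exact ((FieldOn.of_rep (hX.mono ht)).koszul hF (FieldOn.of_rep (hY.mono ht)) hZ).const_mul (1 / 2)⟩

include hF in
theorem Foliation.C_spec {X Y : VField E M} (hX : SmoothFieldOn (s : Set M) X)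
    (hY : SmoothFieldOn (s : Set M) Y) : SmoothFieldOn (s : Set M) (F.C X Y) ∧
    ∀ Z : VField E M, SmoothFieldOn (s : Set M) Z → ∀ y ∈ s, metric (F.C X Y) Z y =
      (1 / 2 : ℝ) * lieMetric (F.hor X) (F.ver Y) (F.ver Z) y :=
  raise_spec fun t ht ↦ ⟨(FunOn.const t (1 / 2) : FunOn E t) • ((F.algebroid hF t).lie
      ((F.algebroid hF t).h (FieldOn.of X (hX.mono ht)))
      ((F.algebroid hF t).v (FieldOn.of Y (hY.mono ht))) ∘ₗ (F.algebroid hF t).v), fun _ _ hZ ↦ by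
    rw [LinearMap.smul_apply]
    exact (((FieldOn.of_rep (hX.mono ht)).hor hF).lie hF ((FieldOn.of_rep (hY.mono ht)).ver hF)
      (hZ.ver hF)).const_mul (1 / 2)⟩

namespace FieldOn

include hF in
/-- The Levi-Civita connection on the fields on `s`. -/
noncomputable def lc (X Y : FieldOn E s) : FieldOn E s :=
  of (leviCivita X.val Y.val) (leviCivita_spec hF X.smooth Y.smooth).1

/-- The tensor `C` on the fields on `s`. -/
noncomputable def tensorC (X Y : FieldOn E s) : FieldOn E s :=
  of (F.C X.val Y.val) (Foliation.C_spec hF X.smooth Y.smooth).1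

end FieldOn

/-- The operations on fields on `s` form a connection pair. -/
theorem isConnectionPair (s : Opens M) : (F.algebroid hF s).IsConnectionPair
    (FieldOn.lc hF) (FieldOn.tensorC hF) where
  two_g_D X Y Z := FunOn.ext' fun y ↦ by
    -- On `s` this is the duality from `leviCivita_spec`; off `s` every term on both sides is zero.
    by_cases hy : y ∈ s
    · have h1 := ((FieldOn.of_rep (leviCivita_spec hF X.smooth Y.smooth).1).metric hF Z.rep_self)
        y hy
      have h2 := (X.rep_self.koszul hF Y.rep_self Z.rep_self) y hy
      have h3 := (leviCivita_spec hF X.smooth Y.smooth).2 Z.val Z.smooth y hy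
      rw [h2]
      refine (congrArg (2 * ·) (h1.trans h3)).trans ?_
      ring
    · simp only [FoliatedAlgebroid.koszul_apply, FunOn.val_add, FunOn.val_sub, FunOn.val_mul,
        Pi.add_apply, Pi.sub_apply, Pi.mul_apply, g_val_of_notMem hF _ _ hy,
        dd_val_of_notMem hF _ _ hy]
      simp
  two_g_C X Y Z := FunOn.ext' fun y ↦ by
    by_cases hy : y ∈ s
    · have h1 := ((FieldOn.of_rep (Foliation.C_spec hF X.smooth Y.smooth).1).metric hF Z.rep_self)
        y hy
      have h2 := ((X.rep_self.hor hF).lie hF (Y.rep_self.ver hF) (Z.rep_self.ver hF)) y hy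
      have h3 := (Foliation.C_spec hF X.smooth Y.smooth).2 Z.val Z.smooth y hy
      rw [h2]
      refine (congrArg (2 * ·) (h1.trans h3)).trans ?_
      ring
    · simp only [FoliatedAlgebroid.lie_apply, FunOn.val_sub, FunOn.val_mul,
        Pi.sub_apply, Pi.mul_apply, g_val_of_notMem hF _ _ hy, dd_val_of_notMem hF _ _ hy]
      simp

namespace FieldOn.Rep

variable {X' Y' Z' : FieldOn E s} {X Y Z : VField E M}

theorem leviCivita (hX : X'.Rep X) (hY : Y'.Rep Y) :
    (FieldOn.lc hF X' Y').Rep (leviCivita X Y) := fun _ hy ↦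
  (FieldOn.of_val (leviCivita_spec hF X'.smooth Y'.smooth).1 hy).trans
    ((hX.eventuallyEq hy).leviCivita_eq (hY.eventuallyEq hy))

theorem tensorC (hX : X'.Rep X) (hY : Y'.Rep Y) :
    (FieldOn.tensorC hF X' Y').Rep (F.C X Y) := fun _ hy ↦
  (FieldOn.of_val (Foliation.C_spec hF X'.smooth Y'.smooth).1 hy).trans
    (F.C_congr (hX.eventuallyEq hy) (hY.eventuallyEq hy))

theorem nabla (hX : X'.Rep X) (hY : Y'.Rep Y) :
    ((F.algebroid hF s).nabOf (FieldOn.lc hF) (FieldOn.tensorC hF) X' Y').Rep (F.nabla X Y) :=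
  ((((hX.hor hF).leviCivita hF (hY.hor hF)).hor hF).add
    (((hX.ver hF).bracket hF (hY.hor hF)).hor hF)).add
    ((((hX.hor hF).bracket hF (hY.ver hF)).ver hF).add ((hX.hor hF).tensorC hF (hY.ver hF)))
    |>.add (((hX.ver hF).leviCivita hF (hY.ver hF)).ver hF)

theorem tor (hX : X'.Rep X) (hY : Y'.Rep Y) :
    ((isConnectionPair hF s).torOf X' Y').Rep (F.Tor X Y) :=
  ((hX.nabla hF hY).sub (hY.nabla hF hX)).sub (hX.bracket hF hY)

theorem riem (hX : X'.Rep X) (hY : Y'.Rep Y) (hZ : Z'.Rep Z) :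
    ((isConnectionPair hF s).riemOf X' Y' Z').Rep (F.Riem X Y Z) :=
  ((hX.nabla hF (hY.nabla hF hZ)).sub (hY.nabla hF (hX.nabla hF hZ))).sub
    ((hX.bracket hF hY).nabla hF hZ)

theorem nablaTor (hX : X'.Rep X) (hY : Y'.Rep Y) (hZ : Z'.Rep Z) :
    ((isConnectionPair hF s).nabTorOf Z' X' Y').Rep (F.nablaTor X Y Z) :=
  ((hX.nabla hF (hY.tor hF hZ)).sub ((hX.nabla hF hY).tor hF hZ)).sub
    (hY.tor hF (hX.nabla hF hZ))

end FieldOn.Rep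

-- The form to be dualised is function-linear because the torsion is a tensor.
include hF in
theorem Foliation.J_spec {Z X : VField E M} (hZ : SmoothFieldOn (s : Set M) Z)
    (hX : SmoothFieldOn (s : Set M) X) : SmoothFieldOn (s : Set M) (F.J Z X) ∧
    ∀ Y : VField E M, SmoothFieldOn (s : Set M) Y → ∀ y ∈ s, metric (F.J Z X) Y y =
      metric Z (F.Tor X Y) y :=
  raise_spec fun t ht ↦ ⟨(F.algebroid hF t).g (FieldOn.of Z (hZ.mono ht)) ∘ₗ
      (isConnectionPair hF t).torOf (FieldOn.of X (hX.mono ht)), fun _ _ hY ↦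
    (FieldOn.of_rep (hZ.mono ht)).metric hF ((FieldOn.of_rep (hX.mono ht)).tor hF hY)⟩

/-- The endomorphism `J_Z` on the fields on `s`. -/
noncomputable def FieldOn.endoJ (Z X : FieldOn E s) : FieldOn E s :=
  of (F.J Z.val X.val) (Foliation.J_spec hF Z.smooth X.smooth).1

theorem FieldOn.Rep.endoJ {X' Z' : FieldOn E s} {X Z : VField E M} (hZ : Z'.Rep Z)
    (hX : X'.Rep X) : (FieldOn.endoJ hF Z' X').Rep (F.J Z X) := fun _ hy ↦
  (FieldOn.of_val (Foliation.J_spec hF Z'.smooth X'.smooth).1 hy).trans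
    (F.J_congr (hZ.eventuallyEq hy) (hX.eventuallyEq hy))

theorem FieldOn.g_endoJ (Z X Y : FieldOn E s) : (F.algebroid hF s).g (FieldOn.endoJ hF Z X) Y =
    (F.algebroid hF s).g Z ((isConnectionPair hF s).torOf X Y) := FunOn.ext' fun y ↦ by
  by_cases hy : y ∈ s
  · rw [((Z.rep_self.endoJ hF X.rep_self).metric hF Y.rep_self) y hy,
      (Z.rep_self.metric hF (X.rep_self.tor hF Y.rep_self)) y hy]
    exact (Foliation.J_spec hF Z.smooth X.smooth).2 Y.val Y.smooth y hy
  · rw [g_val_of_notMem hF _ _ hy, g_val_of_notMem hF _ _ hy]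

end Transfer

/-! ### Traces over the horizontal bundle -/

section Traces

variable {E : Type*} [NormedAddCommGroup E] [NormedSpace ℝ E] [FiniteDimensional ℝ E]
  {M : Type*} [TopologicalSpace M] [ChartedSpace E M] [IsManifold 𝓘(ℝ, E) ∞ M]
  [RiemannianBundle (fun x : M ↦ TangentSpace 𝓘(ℝ, E) x)]
  {m : ℕ} {F : Foliation E M m}

theorem Foliation.horBasisField_self (x : M) (k : Fin (Module.finrank ℝ (F.H x))) :
    F.horBasisField x k x = stdOrthonormalBasis ℝ (F.H x) k := by
  rw [Foliation.horBasisField, F.hor_eq_self, extendVec_self]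
  rw [extendVec_self]
  exact Subtype.prop _

variable [IsContMDiffRiemannianBundle 𝓘(ℝ, E) ∞ E (fun x : M ↦ TangentSpace 𝓘(ℝ, E) x)]
  (hF : F.IsBundleLike)

/-- The basis fields are smooth on a common neighbourhood and horizontal throughout it, though
orthonormality is known only at `x`. -/
theorem exists_rep_horBasisField {s : Set M} (hs : IsOpen s) {x : M} (hx : x ∈ s) :
    ∃ t : Opens M, (t : Set M) ⊆ s ∧ x ∈ t ∧
      ∃ e : Fin (Module.finrank ℝ (F.H x)) → FieldOn E t,
        (∀ k, (e k).Rep (F.horBasisField x k)) ∧ ∀ k, (F.algebroid hF t).h (e k) = e k := by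
  obtain ⟨u, hu, hxu, hsm, -⟩ := exists_linearIndependent_extendVec (M := M) (x := x)
    (w := fun k ↦ ((stdOrthonormalBasis ℝ (F.H x) k : F.H x) : TangentSpace 𝓘(ℝ, E) x))
    ((stdOrthonormalBasis ℝ (F.H x)).toBasis.linearIndependent.map' (F.H x).subtype
      (Submodule.ker_subtype _) |> fun h ↦ by simpa [Function.comp_def] using h)
  let t : Opens M := ⟨s ∩ u, hs.inter hu⟩
  have ht : ∀ k, SmoothFieldOn (t : Set M) (F.horBasisField x k) := fun k ↦
    F.smoothFieldOn_hor t.isOpen ((hsm k).mono inter_subset_right)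
  refine ⟨t, inter_subset_left, ⟨hx, hxu⟩, fun k ↦ FieldOn.of _ (ht k), fun k ↦
    FieldOn.of_rep (ht k), fun k ↦ ((FieldOn.of_rep (ht k)).hor hF).unique fun y hy ↦ ?_⟩
  rw [FieldOn.of_val (ht k) hy]
  exact (F.hor_eq_self (F.hor_mem _ y)).symm

variable {t : Opens M}

theorem FieldOn.h_eq_self {X' : FieldOn E t} {X : VField E M} (hX : X'.Rep X)
    (h : ∀ y, X y ∈ F.H y) : (F.algebroid hF t).h X' = X' :=
  (hX.hor hF).unique fun y hy ↦ by rw [F.hor_eq_self (h y), hX y hy]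

theorem FieldOn.v_eq_self {X' : FieldOn E t} {X : VField E M} (hX : X'.Rep X)
    (h : ∀ y, X y ∈ F.V y) : (F.algebroid hF t).v X' = X' :=
  (hX.ver hF).unique fun y hy ↦ by rw [F.ver_eq_self (h y), hX y hy]

/-- The endomorphism `J_Z` as a linear map. -/
noncomputable def FieldOn.linJ (Z : FieldOn E t) : FieldOn E t →ₗ[FunOn E t] FieldOn E t :=
  (isConnectionPair hF t).linearOf (FieldOn.endoJ hF) (FieldOn.g_endoJ hF) Z

theorem FieldOn.g_linJ (Z X Y : FieldOn E t) : (F.algebroid hF t).g (FieldOn.linJ hF Z X) Y =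
    (F.algebroid hF t).g Z ((isConnectionPair hF t).torOf X Y) := FieldOn.g_endoJ hF Z X Y

/-- The polarised summand of `𝔯` on the fields on `t`. -/
noncomputable def frakRBilin (U V : FieldOn E t) :
    FieldOn E t →ₗ[FunOn E t] FieldOn E t →ₗ[FunOn E t] FunOn E t :=
  (isConnectionPair hF t).frakROf (FunOn.const t (1 / 4)) (FieldOn.linJ hF) U V

theorem FieldOn.Rep.frakRTerm {U' V' X' : FieldOn E t} {U V X : VField E M} (hU : U'.Rep U)
    (hV : V'.Rep V) (hX : X'.Rep X) :
    (frakRBilin hF U' V' X' X').Rep (F.frakRTerm U V X) :=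
  (((((hU.riem hF hX hX).metric hF hV).sub ((hX.nablaTor hF hX hU).metric hF hV)).sub
    (((hU.tor hF hX).tor hF hX).metric hF hV)).add
    (((((hU.endoJ hF hX).hor hF).metric hF ((hV.endoJ hF hX).hor hF))).const_mul (1 / 4))).sub
    ((hX.tor hF hU).metric hF (hX.tor hF hV))

include hF in
/-- The trace of a bilinear expression can be computed in any orthonormal horizontal frame. -/
theorem sum_horBasisField_eq {n : ℕ} {s : Set M} {X : Fin n → VField E M}
    (hX : F.IsHorizontalFrame s X) (hts : (t : Set M) ⊆ s) {x : M} (hx : x ∈ t)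
    {e : Fin (Module.finrank ℝ (F.H x)) → FieldOn E t} (he : ∀ k, (e k).Rep (F.horBasisField x k))
    {X' : Fin n → FieldOn E t} (hX' : ∀ i, (X' i).Rep (X i))
    {N W : Type*} [AddCommGroup N] [Module (FunOn E t) N] [AddCommGroup W] [Module ℝ W]
    (ev : N →+ W) (hev : ∀ (f : FunOn E t) (p : N), ev (f • p) = f.val x • ev p)
    (B : FieldOn E t →ₗ[FunOn E t] FieldOn E t →ₗ[FunOn E t] N) :
    ∑ k, ev (B (e k) (e k)) = ∑ i, ev (B (X' i) (X' i)) := by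
  classical
  -- The frame `X` is orthonormal on the whole neighbourhood, so the coefficients are smooth
  -- functions and can be pulled out of `B`.
  have expand : ∀ k, e k = ∑ i, (F.algebroid hF t).g (e k) (X' i) • X' i := fun k ↦ by
    refine FieldOn.ext_on fun y hy ↦ ?_
    have hmem : F.horBasisField x k y ∈ F.H y := F.hor_mem _ y
    rw [← hX.span_eq y (hts hy), Submodule.mem_span_range_iff_exists_fun] at hmem
    obtain ⟨c, hc⟩ := hmem
    rw [FieldOn.val_sum, he k y hy, ← hc]
    refine Finset.sum_congr rfl fun i _ ↦ ?_
    rw [FieldOn.val_smul, Pi.smul_apply', (he k).metric hF (hX' i) y hy, hX' i y hy, metric, ← hc,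
      (hX.orthonormal y (hts hy)).inner_left_fintype]
    simp
  -- At `x` both families are orthonormal bases of `H_x`; this is Parseval's identity, saying that
  -- the change of basis is orthogonal.
  have delta : ∀ i j, ∑ k, metric (F.horBasisField x k) (X i) x
      * metric (F.horBasisField x k) (X j) x = if i = j then 1 else 0 := fun i j ↦ by
    have mem : ∀ i, X i x ∈ F.H x := fun i ↦ by
      rw [← hX.span_eq x (hts hx)]; exact Submodule.subset_span ⟨i, rfl⟩
    have := (stdOrthonormalBasis ℝ (F.H x)).sum_inner_mul_inner ⟨X i x, mem i⟩ ⟨X j x, mem j⟩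
    rw [← orthonormal_iff_ite.1 (hX.orthonormal x (hts hx)) i j]
    refine Eq.trans (Finset.sum_congr rfl fun k _ ↦ ?_) this
    rw [metric, metric, F.horBasisField_self, real_inner_comm]
    rfl
  have step : ∀ k, ev (B (e k) (e k)) = ∑ i, ∑ j, (metric (F.horBasisField x k) (X i) x
      * metric (F.horBasisField x k) (X j) x) • ev (B (X' i) (X' j)) := fun k ↦ by
    conv_lhs => rw [expand k]
    simp only [map_sum, map_smul, LinearMap.sum_apply, LinearMap.smul_apply, hev, Finset.smul_sum,
      smul_smul, FunOn.val_mul, Pi.mul_apply, (he k).metric hF (hX' _) x hx]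
    rw [Finset.sum_comm]
    exact Finset.sum_congr rfl fun i _ ↦ Finset.sum_congr rfl fun j _ ↦ by rw [mul_comm]
  simp only [step]
  rw [Finset.sum_comm]
  refine Finset.sum_congr rfl fun i _ ↦ ?_
  rw [Finset.sum_comm]
  simp only [← Finset.sum_smul, delta, ite_smul, one_smul, zero_smul]
  simp

end Traces

/-! ### Frame formulas, the blocks of `𝔯`, and the Yang–Mills criterion -/

section Blocks

variable {E : Type*} [NormedAddCommGroup E] [NormedSpace ℝ E] [FiniteDimensional ℝ E]
  {M : Type*} [TopologicalSpace M] [ChartedSpace E M] [IsManifold 𝓘(ℝ, E) ∞ M]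
  [RiemannianBundle (fun x : M ↦ TangentSpace 𝓘(ℝ, E) x)]
  [IsContMDiffRiemannianBundle 𝓘(ℝ, E) ∞ E (fun x : M ↦ TangentSpace 𝓘(ℝ, E) x)]
  {m : ℕ} {F : Foliation E M m} (hF : F.IsBundleLike)

include hF

/-- Frame independence needs only that `Q` is the diagonal of a function-bilinear map on
representing fields; evaluation at `x` plays the role of `ev`. -/
theorem trH_fun_eq {n : ℕ} {s : Set M} {X : Fin n → VField E M} (hX : F.IsHorizontalFrame s X)
    {x : M} (hx : x ∈ s) {Q : VField E M → M → ℝ}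
    (hQ : ∀ t : Opens M, ∃ B : FieldOn E t →ₗ[FunOn E t] FieldOn E t →ₗ[FunOn E t] FunOn E t,
      ∀ (Y' : FieldOn E t) (Y : VField E M), Y'.Rep Y → (B Y' Y').Rep (Q Y)) :
    F.trH (A := fun _ ↦ ℝ) Q x = ∑ i, Q (X i) x := by
  obtain ⟨t, hts, hxt, e, he, -⟩ := exists_rep_horBasisField hF hX.isOpen hx
  obtain ⟨B, hB⟩ := hQ t
  have hX' := fun i ↦ FieldOn.of_rep ((hX.smooth i).mono hts)
  let ev : FunOn E t →+ ℝ := AddMonoidHom.mk' (fun f ↦ f.val x) fun _ _ ↦ rfl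
  have key := sum_horBasisField_eq hF hX hts hxt he hX' ev (fun _ _ ↦ rfl) B
  refine Eq.trans (Finset.sum_congr rfl fun k _ ↦ ?_) (key.trans (Finset.sum_congr rfl fun i _ ↦ ?_))
  · exact (hB _ _ (he k) x hxt).symm
  · exact hB _ _ (hX' i) x hxt

theorem trH_field_eq {n : ℕ} {s : Set M} {X : Fin n → VField E M} (hX : F.IsHorizontalFrame s X)
    {x : M} (hx : x ∈ s) {Q : VField E M → VField E M}
    (hQ : ∀ t : Opens M, ∃ B : FieldOn E t →ₗ[FunOn E t] FieldOn E t →ₗ[FunOn E t] FieldOn E t,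
      ∀ (Y' : FieldOn E t) (Y : VField E M), Y'.Rep Y → (B Y' Y').Rep (Q Y)) :
    F.trH (A := fun x ↦ TangentSpace 𝓘(ℝ, E) x) Q x = ∑ i, Q (X i) x := by
  obtain ⟨t, hts, hxt, e, he, -⟩ := exists_rep_horBasisField hF hX.isOpen hx
  obtain ⟨B, hB⟩ := hQ t
  have hX' := fun i ↦ FieldOn.of_rep ((hX.smooth i).mono hts)
  let ev : FieldOn E t →+ TangentSpace 𝓘(ℝ, E) x := AddMonoidHom.mk' (fun f ↦ f.val x) fun _ _ ↦ rfl
  have key := sum_horBasisField_eq hF hX hts hxt he hX' ev (fun _ _ ↦ rfl) B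
  refine Eq.trans (Finset.sum_congr rfl fun k _ ↦ ?_) (key.trans (Finset.sum_congr rfl fun i _ ↦ ?_))
  · exact (hB _ _ (he k) x hxt).symm
  · exact hB _ _ (hX' i) x hxt

section Frame

variable {n : ℕ} {s : Set M} {X : Fin n → VField E M} (hX : F.IsHorizontalFrame s X)
  {U V : VField E M} (hU : SmoothField U) (hV : SmoothField V) {x : M} (hx : x ∈ s)

include hX hU hx

theorem divTor_eq_sum : F.divTor U x = ∑ i, F.nablaTor (X i) (X i) U x :=
  trH_field_eq hF hX hx (Q := fun X ↦ F.nablaTor X X U) fun t ↦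
    ⟨(isConnectionPair hF t).nabTorOf (FieldOn.of U (hU.smoothFieldOn t)), fun _ _ hY ↦
      hY.nablaTor hF hY (FieldOn.of_rep (hU.smoothFieldOn t))⟩

include hV

theorem frakR_eq_sum : F.frakR U V x = ∑ i, F.frakRTerm U V (X i) x :=
  trH_fun_eq hF hX hx (Q := F.frakRTerm U V) fun t ↦
    ⟨frakRBilin hF (FieldOn.of U (hU.smoothFieldOn t)) (FieldOn.of V (hV.smoothFieldOn t)),
      fun _ _ hY ↦ (FieldOn.of_rep (hU.smoothFieldOn t)).frakRTerm hF
        (FieldOn.of_rep (hV.smoothFieldOn t)) hY⟩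

theorem ricH_eq_sum : F.ricH U V x = ∑ i, metric (F.Riem U (X i) (X i)) V x :=
  trH_fun_eq hF hX hx (Q := fun X ↦ metric (F.Riem U X X) V) fun t ↦ by
    refine ⟨((isConnectionPair hF t).riemOf (FieldOn.of U (hU.smoothFieldOn t))).compr₂
      ((F.algebroid hF t).g.flip (FieldOn.of V (hV.smoothFieldOn t))), fun Y' Y hY ↦ ?_⟩
    rw [LinearMap.compr₂_apply, LinearMap.flip_apply]
    exact ((FieldOn.of_rep (hU.smoothFieldOn t)).riem hF hY hY).metric hF
      (FieldOn.of_rep (hV.smoothFieldOn t))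

theorem torTor_eq_sum : F.torTor U V x = ∑ i, metric (F.Tor U (X i)) (F.Tor V (X i)) x :=
  trH_fun_eq hF hX hx (Q := fun X ↦ metric (F.Tor U X) (F.Tor V X)) fun t ↦
    ⟨(F.algebroid hF t).g.compl₁₂
      ((isConnectionPair hF t).torOf (FieldOn.of U (hU.smoothFieldOn t)))
      ((isConnectionPair hF t).torOf (FieldOn.of V (hV.smoothFieldOn t))), fun _ _ hY ↦
      ((FieldOn.of_rep (hU.smoothFieldOn t)).tor hF hY).metric hF
        ((FieldOn.of_rep (hV.smoothFieldOn t)).tor hF hY)⟩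

theorem JJ_eq_sum : F.JJ U V x = ∑ i, F.metricH (F.J U (X i)) (F.J V (X i)) x :=
  trH_fun_eq hF hX hx (Q := fun X ↦ F.metricH (F.J U X) (F.J V X)) fun t ↦
    ⟨(F.algebroid hF t).g.compl₁₂
      ((F.algebroid hF t).h ∘ₗ FieldOn.linJ hF (FieldOn.of U (hU.smoothFieldOn t)))
      ((F.algebroid hF t).h ∘ₗ FieldOn.linJ hF (FieldOn.of V (hV.smoothFieldOn t))), fun _ _ hY ↦
      (((FieldOn.of_rep (hU.smoothFieldOn t)).endoJ hF hY).hor hF).metric hF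
        (((FieldOn.of_rep (hV.smoothFieldOn t)).endoJ hF hY).hor hF)⟩

end Frame

/-- All traces use the same basis fields, so it suffices to compare summands, where the algebraic
identity for one horizontal field is evaluated at `x`. -/
theorem frakR_hor_hor {X Y : VField E M} (hX : F.HorizontalField X) (hY : F.HorizontalField Y)
    (x : M) : F.frakR X Y x = F.frakR Y X x ∧
      F.frakR X Y x = F.ricH X Y x - F.torTor X Y x := by
  obtain ⟨t, -, hxt, e, he, hhe⟩ := exists_rep_horBasisField hF isOpen_univ (mem_univ x)
  have rX := FieldOn.of_rep (hX.1.smoothFieldOn t)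
  have rY := FieldOn.of_rep (hY.1.smoothFieldOn t)
  have eX := FieldOn.h_eq_self hF rX hX.2
  have eY := FieldOn.h_eq_self hF rY hY.2
  simp only [Foliation.frakR, Foliation.ricH, Foliation.torTor, Foliation.trH,
    ← Finset.sum_sub_distrib]
  refine ⟨Finset.sum_congr rfl fun k _ ↦ ?_, Finset.sum_congr rfl fun k _ ↦ ?_⟩
  · have h := (isConnectionPair hF t).frakROf_h_h_symm (q := FunOn.const t (1 / 4))
      (FieldOn.g_linJ hF) (FieldOn.of X (hX.1.smoothFieldOn t))
      (FieldOn.of Y (hY.1.smoothFieldOn t)) (e k)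
    rw [eX, eY, hhe] at h
    rw [← rX.frakRTerm hF rY (he k) x hxt, ← rY.frakRTerm hF rX (he k) x hxt]
    exact congrArg (fun f ↦ f.val x) h
  · have h := (isConnectionPair hF t).frakROf_h_h (q := FunOn.const t (1 / 4))
      (FieldOn.g_linJ hF) (FieldOn.of X (hX.1.smoothFieldOn t))
      (FieldOn.of Y (hY.1.smoothFieldOn t)) (e k)
    rw [eX, eY, hhe] at h
    rw [← rX.frakRTerm hF rY (he k) x hxt,
      ← (rX.riem hF (he k) (he k)).metric hF rY x hxt,
      ← (rX.tor hF (he k)).metric hF (rY.tor hF (he k)) x hxt]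
    exact congrArg (fun f ↦ f.val x) h

theorem frakR_ver_hor {U X : VField E M} (hU : F.VerticalField U) (hX : F.HorizontalField X)
    (x : M) : F.frakR U X x = -F.torTor U X x := by
  obtain ⟨t, -, hxt, e, he, hhe⟩ := exists_rep_horBasisField hF isOpen_univ (mem_univ x)
  have rX := FieldOn.of_rep (hX.1.smoothFieldOn t)
  have rU := FieldOn.of_rep (hU.1.smoothFieldOn t)
  have eX := FieldOn.h_eq_self hF rX hX.2
  have eU := FieldOn.v_eq_self hF rU hU.2
  simp only [Foliation.frakR, Foliation.torTor, Foliation.trH, ← Finset.sum_neg_distrib]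
  refine Finset.sum_congr rfl fun k _ ↦ ?_
  have h := (isConnectionPair hF t).frakROf_v_h (q := FunOn.const t (1 / 4))
    (FieldOn.g_linJ hF) (FieldOn.of U (hU.1.smoothFieldOn t))
    (FieldOn.of X (hX.1.smoothFieldOn t)) (e k)
  rw [eX, eU, hhe] at h
  rw [← rU.frakRTerm hF rX (he k) x hxt,
    ← (rU.tor hF (he k)).metric hF (rX.tor hF (he k)) x hxt]
  exact congrArg (fun f ↦ f.val x) h

omit hF in
omit [IsContMDiffRiemannianBundle 𝓘(ℝ, E) ∞ E (fun x : M ↦ TangentSpace 𝓘(ℝ, E) x)] in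
theorem metric_divTor (X U : VField E M) (x : M) : metric (F.divTor X) U x =
    ∑ k, metric (F.nablaTor (F.horBasisField x k) (F.horBasisField x k) X) U x := by
  simp only [metric, Foliation.divTor, Foliation.trH]
  exact sum_inner _ _ _

theorem frakR_hor_ver {U X : VField E M} (hU : F.VerticalField U) (hX : F.HorizontalField X)
    (x : M) : F.frakR X U x = -metric (F.divTor X) U x - 2 * F.torTor U X x := by
  obtain ⟨t, -, hxt, e, he, hhe⟩ := exists_rep_horBasisField hF isOpen_univ (mem_univ x)
  have rX := FieldOn.of_rep (hX.1.smoothFieldOn t)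
  have rU := FieldOn.of_rep (hU.1.smoothFieldOn t)
  have eX := FieldOn.h_eq_self hF rX hX.2
  have eU := FieldOn.v_eq_self hF rU hU.2
  simp only [metric_divTor, Foliation.frakR, Foliation.torTor, Foliation.trH, Finset.mul_sum,
    ← Finset.sum_neg_distrib, ← Finset.sum_sub_distrib]
  refine Finset.sum_congr rfl fun k _ ↦ ?_
  have h := (isConnectionPair hF t).frakROf_h_v (q := FunOn.const t (1 / 4))
    (FieldOn.g_linJ hF) (FieldOn.of U (hU.1.smoothFieldOn t))
    (FieldOn.of X (hX.1.smoothFieldOn t)) (e k)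
  rw [eX, eU, hhe] at h
  rw [← rX.frakRTerm hF rU (he k) x hxt, ← ((he k).nablaTor hF (he k) rX).metric hF rU x hxt,
    ← (rU.tor hF (he k)).metric hF (rX.tor hF (he k)) x hxt]
  exact congrArg (fun f ↦ f.val x) h

theorem frakR_ver_ver {U V : VField E M} (hU : F.VerticalField U) (hV : F.VerticalField V)
    (x : M) : F.frakR U V x = F.frakR V U x ∧
      F.frakR U V x
        = -metric (F.divTor U) V x + (1 / 4 : ℝ) * F.JJ U V x - 2 * F.torTor U V x := by
  obtain ⟨t, -, hxt, e, he, hhe⟩ := exists_rep_horBasisField hF isOpen_univ (mem_univ x)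
  have rU := FieldOn.of_rep (hU.1.smoothFieldOn t)
  have rV := FieldOn.of_rep (hV.1.smoothFieldOn t)
  have eU := FieldOn.v_eq_self hF rU hU.2
  have eV := FieldOn.v_eq_self hF rV hV.2
  simp only [metric_divTor, Foliation.frakR, Foliation.torTor, Foliation.JJ, Foliation.trH,
    Finset.mul_sum, ← Finset.sum_neg_distrib, ← Finset.sum_add_distrib,
    ← Finset.sum_sub_distrib]
  refine ⟨Finset.sum_congr rfl fun k _ ↦ ?_, Finset.sum_congr rfl fun k _ ↦ ?_⟩
  · have h := (isConnectionPair hF t).frakROf_v_v_symm (q := FunOn.const t (1 / 4))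
      (j := FieldOn.linJ hF) (FieldOn.of U (hU.1.smoothFieldOn t))
      (FieldOn.of V (hV.1.smoothFieldOn t)) (e k)
    rw [eU, eV, hhe] at h
    rw [← rU.frakRTerm hF rV (he k) x hxt, ← rV.frakRTerm hF rU (he k) x hxt]
    exact congrArg (fun f ↦ f.val x) h
  · have h := (isConnectionPair hF t).frakROf_v_v (q := FunOn.const t (1 / 4))
      (j := FieldOn.linJ hF) (FieldOn.of U (hU.1.smoothFieldOn t))
      (FieldOn.of V (hV.1.smoothFieldOn t)) (e k)
    rw [eU, eV, hhe] at h
    rw [← rU.frakRTerm hF rV (he k) x hxt, ← ((he k).nablaTor hF (he k) rU).metric hF rV x hxt,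
      ← (rU.tor hF (he k)).metric hF (rV.tor hF (he k)) x hxt, Foliation.metricH,
      ← ((rU.endoJ hF (he k)).hor hF).metric hF ((rV.endoJ hF (he k)).hor hF) x hxt]
    exact congrArg (fun f ↦ f.val x) h

/-- Each summand is additive in both arguments once `U` and `V` are represented in the algebroid. -/
theorem frakR_eq_sum_blocks {U V : VField E M} (hU : SmoothField U) (hV : SmoothField V) (x : M) :
    F.frakR U V x = F.frakR (F.hor U) (F.hor V) x + F.frakR (F.hor U) (F.ver V) x
      + (F.frakR (F.ver U) (F.hor V) x + F.frakR (F.ver U) (F.ver V) x) := by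
  obtain ⟨t, -, hxt, e, he, -⟩ := exists_rep_horBasisField hF isOpen_univ (mem_univ x)
  have rU := FieldOn.of_rep (hU.smoothFieldOn t)
  have rV := FieldOn.of_rep (hV.smoothFieldOn t)
  simp only [Foliation.frakR, Foliation.trH, ← Finset.sum_add_distrib]
  refine Finset.sum_congr rfl fun k _ ↦ ?_
  rw [← rU.frakRTerm hF rV (he k) x hxt,
    ← (rU.hor hF).frakRTerm hF (rV.hor hF) (he k) x hxt,
    ← (rU.hor hF).frakRTerm hF (rV.ver hF) (he k) x hxt,
    ← (rU.ver hF).frakRTerm hF (rV.hor hF) (he k) x hxt,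
    ← (rU.ver hF).frakRTerm hF (rV.ver hF) (he k) x hxt]
  have h : ∀ U V : FieldOn E t, frakRBilin hF U V (e k) (e k) =
      frakRBilin hF ((F.algebroid hF t).h U) ((F.algebroid hF t).h V) (e k) (e k)
      + frakRBilin hF ((F.algebroid hF t).h U) ((F.algebroid hF t).v V) (e k) (e k)
      + (frakRBilin hF ((F.algebroid hF t).v U) ((F.algebroid hF t).h V) (e k) (e k)
      + frakRBilin hF ((F.algebroid hF t).v U) ((F.algebroid hF t).v V) (e k) (e k)) :=
      fun U V ↦ by
    have r := (isConnectionPair hF t).frakROf_add_right (q := FunOn.const t (1 / 4))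
      (FieldOn.g_linJ hF)
    have l := (isConnectionPair hF t).frakROf_add_left (q := FunOn.const t (1 / 4))
      (FieldOn.g_linJ hF)
    simp only [frakRBilin]
    rw [← r, ← r, ← l, (F.algebroid hF t).h_add_v, (F.algebroid hF t).h_add_v]
  exact congrArg (fun f ↦ f.val x) (h _ _)

/-- Equating the two mixed blocks gives precisely the Yang–Mills equation. Conversely, after
splitting `U` and `V`, only the mixed blocks can be asymmetric, and the equation is needed for both
pairs of a vertical and a horizontal part. -/
theorem frakR_symm_iff_isYangMills :
    (∀ U V : VField E M, SmoothField U → SmoothField V → ∀ x, F.frakR U V x = F.frakR V U x) ↔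
      F.IsYangMills := by
  constructor
  · intro h U X hU hX x
    have := h U X hU.1 hX.1 x
    rw [frakR_ver_hor hF hU hX, frakR_hor_ver hF hU hX] at this
    linarith
  · intro h U V hU hV x
    have hor : ∀ {U : VField E M}, SmoothField U → F.HorizontalField (F.hor U) := fun hU ↦
      ⟨contMDiffOn_univ.1 (F.smoothFieldOn_hor isOpen_univ (hU.smoothFieldOn univ)), F.hor_mem _⟩
    have ver : ∀ {U : VField E M}, SmoothField U → F.VerticalField (F.ver U) := fun hU ↦
      ⟨contMDiffOn_univ.1 (F.smoothFieldOn_ver isOpen_univ (hU.smoothFieldOn univ)), F.ver_mem _⟩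
    rw [frakR_eq_sum_blocks hF hU hV, frakR_eq_sum_blocks hF hV hU,
      (frakR_hor_hor hF (hor hU) (hor hV) x).1, (frakR_ver_ver hF (ver hU) (ver hV) x).1,
      frakR_hor_ver hF (ver hV) (hor hU), frakR_hor_ver hF (ver hU) (hor hV),
      frakR_ver_hor hF (ver hV) (hor hU), frakR_ver_hor hF (ver hU) (hor hV)]
    have h1 := h _ _ (ver hU) (hor hV) x
    have h2 := h _ _ (ver hV) (hor hU) x
    linarith

end Blocks

theorem mainTheorem12
    {E : Type*} [NormedAddCommGroup E] [NormedSpace ℝ E] [FiniteDimensional ℝ E]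
    {M : Type*} [TopologicalSpace M] [T2Space M] [SecondCountableTopology M]
    [ChartedSpace E M] [IsManifold 𝓘(ℝ, E) ∞ M]
    [RiemannianBundle (fun x : M ↦ TangentSpace 𝓘(ℝ, E) x)]
    [IsContMDiffRiemannianBundle 𝓘(ℝ, E) ∞ E (fun x : M ↦ TangentSpace 𝓘(ℝ, E) x)]
    {n m : ℕ} (hdim : Module.finrank ℝ E = n + m)
    (F : Foliation E M m) (hF : F.IsBundleLike) :
    -- the traces can be computed in an arbitrary local orthonormal horizontal frame
    (∀ (s : Set M) (X : Fin n → VField E M), F.IsHorizontalFrame s X →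
      ∀ U V : VField E M, SmoothField U → SmoothField V → ∀ x ∈ s,
        F.frakR U V x = ∑ i, F.frakRTerm U V (X i) x ∧
        F.ricH U V x = ∑ i, metric (F.Riem U (X i) (X i)) V x ∧
        F.divTor U x = ∑ i, F.nablaTor (X i) (X i) U x ∧
        F.torTor U V x = ∑ i, metric (F.Tor U (X i)) (F.Tor V (X i)) x ∧
        F.JJ U V x = ∑ i, F.metricH (F.J U (X i)) (F.J V (X i)) x) ∧
    -- the horizontal-horizontal block
    (∀ X Y : VField E M, F.HorizontalField X → F.HorizontalField Y → ∀ x,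
      F.frakR X Y x = F.frakR Y X x ∧
      F.frakR X Y x = F.ricH X Y x - F.torTor X Y x) ∧
    -- the vertical-horizontal block
    (∀ U X : VField E M, F.VerticalField U → F.HorizontalField X → ∀ x,
      F.frakR U X x = -F.torTor U X x) ∧
    -- the horizontal-vertical block
    (∀ U X : VField E M, F.VerticalField U → F.HorizontalField X → ∀ x,
      F.frakR X U x = -metric (F.divTor X) U x - 2 * F.torTor U X x) ∧
    -- the vertical-vertical block
    (∀ U V : VField E M, F.VerticalField U → F.VerticalField V → ∀ x,
      F.frakR U V x = F.frakR V U x ∧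
      F.frakR U V x
        = -metric (F.divTor U) V x + (1 / 4 : ℝ) * F.JJ U V x - 2 * F.torTor U V x) ∧
    -- symmetry is equivalent to the Yang-Mills condition
    ((∀ U V : VField E M, SmoothField U → SmoothField V → ∀ x, F.frakR U V x = F.frakR V U x) ↔
      F.IsYangMills) :=
  ⟨fun _ _ hX _ _ hU hV _ hx ↦ ⟨frakR_eq_sum hF hX hU hV hx, ricH_eq_sum hF hX hU hV hx,
      divTor_eq_sum hF hX hU hx, torTor_eq_sum hF hX hU hV hx, JJ_eq_sum hF hX hU hV hx⟩,
    fun _ _ hX hY x ↦ frakR_hor_hor hF hX hY x, fun _ _ hU hX x ↦ frakR_ver_hor hF hU hX x,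
    fun _ _ hU hX x ↦ frakR_hor_ver hF hU hX x, fun _ _ hU hV x ↦ frakR_ver_ver hF hU hV x,
    frakR_symm_iff_isYangMills hF⟩
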